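/- Let $n\ge 0$ be an integer, $T>0$, $\omega=2\pi/T$, and let $A:\mathbb R\to\mathbb R^{n\times n}$ be $T$-periodic with entries $a_{ij}\in L^\infty([0,T])$ and Fourier coefficients $a_{ij,k}=\frac1T\int_0^T a_{ij}(\tau)e^{-j\omega k\tau}\,d\tau$. On $\ell^2(\{1,\dots,n\}\times\mathbb Z)$ consider the (unbounded, maximal) operator $\mathcal A-\mathcal N$ with matrix entries $a_{ij,k-l}-j\omega k\,\delta_{(i,k),(j,l)}$ in row $(i,k)$ and column $(j,l)$. For $m\in\mathbb N$ let $\mathcal A_{m^+}-\mathcal N_{m^+}$, $\mathcal A_{m^-}-\mathcal N_{m^-}$ and $\mathcal A_m-\mathcal N_m$ be its left, right and two-sided $m$-truncations, obtained by keeping in every block only the rows and columns with index $k\ge -m$, $k\le m$ and $|k|\le m$ respectively, and let $\Lambda_{m^+},\Lambda_{m^-},\Lambda_m$ be their sets of eigenvalues (with eigenvectors in $\ell^2$). Write $V|_m$, $V|_{m^+}$ for the corresponding truncations of a vector $V$. An operator $M$ is called non-defective if $\ker (M-z)^2=\ker(M-z)$ for all $z\in\mathbb C$. For sets $S,S'\subset\mathbb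 C$ write $S\approx_\epsilon S'$ if every point of either set is at distance less than $\epsilon$ from some point of the other. **Theorem.** Assume that $\mathcal A-\mathcal N$ is non-defective and let $\lambda_1,\dots,\lambda_n$ be such that its spectrum is $\sigma=\{\lambda_p+j\omega k:\ k\in\mathbb Z,\ p=1,\dots,n\}$. Let $\epsilon>0$. Then there are an index $j_0\in\mathbb N$ and finite sets $\Lambda_2^+(m)\subset\Lambda_{m^+}$ $(m\in\mathbb N)$, such that the following holds. (a) For every $m\in\mathbb N$, $\Lambda_2^+(m+1)=\Lambda_2^+(m)+j\omega$, and, with $\Lambda_1^+(m)=\{\lambda_p+j\omega k:\ k\le m+1-j_0,\ 1\le p\le n\}$, one has $\Lambda_{m^+}\approx_\epsilon \Lambda_1^+(m)\cup\Lambda_2^+(m)$; moreover each $\lambda\in\Lambda_1^+(m)$ is an eigenvalue of $\mathcal A-\mathcal N$, and $\|(\mathcal A_{m^+}-\mathcal N_{m^+}-\lambda)V|_{m^+}\|_{\ell^2}<\epsilon\,\|V|_{m^+}\|_{\ell^2}$ for each eigenvector $V$ of $\mathcal A-\mathcal N$ associated with $\lambda$. (b) Put $\Lambda_2^-(m)=\overline{\Lambda_2^+(m)}$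 and $\Lambda_1(m)=\{\lambda_p+j\omega k:\ |k|\le m+1-j_0,\ 1\le p\le n\}$. There is $m_0$ such that for every $m\ge m_0$ for which $\mathcal A_m-\mathcal N_m$ is non-defective: 1. each $\lambda_1\in\Lambda_1(m)$ is an eigenvalue of $\mathcal A-\mathcal N$, and each associated eigenvector $V_1$ satisfies $\|(\mathcal A_m-\mathcal N_m-\lambda_1)V_1|_m\|_{\ell^2}<\epsilon\,\|V_1|_m\|_{\ell^2}$; 2. each $\lambda_2\in\Lambda_2^+(m)$ (respectively $\lambda_2\in\Lambda_2^-(m)$) is an eigenvalue of $\mathcal A_{m^+}-\mathcal N_{m^+}$ (respectively of $\mathcal A_{m^-}-\mathcal N_{m^-}$), and each associated eigenvector $V_2$ of that one-sided truncation satisfies $\|(\mathcal A_m-\mathcal N_m-\lambda_2)V_2|_m\|_{\ell^2}<\epsilon\,\|V_2|_m\|_{\ell^2}$; 3. $\Lambda_m\approx_\epsilon\Lambda_1(m)\cup\Lambda_2^-(m)\cup\Lambda_2^+(m)$. -/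

import Mathlib

open MeasureTheory

/-- The Hilbert space `ℓ²(ι)` of square-summable complex families. -/
abbrev EllTwo (ι : Type*) : Type _ := lp (fun _ : ι => ℂ) 2

/-- The `k`-th phasor (Fourier coefficient) `(1/T) ∫₀ᵀ a(τ) e^{-jωkτ} dτ`, `ω = 2π/T`,
of a real `T`-periodic signal. -/
noncomputable def phasor (T : ℝ) (a : ℝ → ℝ) (k : ℤ) : ℂ :=
  (1 / T : ℂ) * ∫ τ in (0 : ℝ)..T,
    (a τ : ℂ) * Complex.exp (-(Complex.I * (2 * Real.pi / T : ℝ) * k * τ))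

/-- The infinite matrix `𝒜 - 𝒩`: its entry in row `(i, k)` and column `(j, l)` is the block
Toeplitz entry `a_{ij, k-l}`, minus `jωk` on the diagonal. -/
noncomputable def harmonicMatrix {n : ℕ} (T : ℝ) (A : ℝ → Matrix (Fin n) (Fin n) ℝ) :
    Matrix (Fin n × ℤ) (Fin n × ℤ) ℂ := fun p q =>
  phasor T (fun t => A t p.1 q.1) (p.2 - q.2)
    - if p = q then Complex.I * (2 * Real.pi / T : ℝ) * p.2 else 0

/-- `V` is in the (maximal) domain on `ℓ²` of the operator with matrix `M`, and `M V = W`. -/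
def MapsVec {ι : Type*} (M : Matrix ι ι ℂ) (V W : EllTwo ι) : Prop :=
  ∀ i, HasSum (fun j => M i j * V j) (W i)

/-- `V` is an eigenvector of `M` in `ℓ²`, with eigenvalue `z`. -/
def IsEigenvector {ι : Type*} (M : Matrix ι ι ℂ) (z : ℂ) (V : EllTwo ι) : Prop :=
  V ≠ 0 ∧ MapsVec M V (z • V)

/-- The set of eigenvalues of `M` on `ℓ²`. -/
def eigenvalueSet {ι : Type*} (M : Matrix ι ι ℂ) : Set ℂ :=
  {z | ∃ V, IsEigenvector M z V}

/-- The spectrum of the (possibly unbounded) operator on `ℓ²` with matrix `M`: those `z` for which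
`M - z`, on its domain, has no bounded two-sided inverse `R`. -/
def operatorSpectrum {ι : Type*} (M : Matrix ι ι ℂ) : Set ℂ :=
  {z | ¬ ∃ R : EllTwo ι →L[ℂ] EllTwo ι, ∀ V W, MapsVec M V (W + z • V) ↔ V = R W}

/-- `M` is non-defective: it has no generalized eigenvector of rank two, that is,
`ker (M - z)² = ker (M - z)` for every `z`. -/
def IsNonDefective {ι : Type*} (M : Matrix ι ι ℂ) : Prop :=
  ∀ (z : ℂ) (V U : EllTwo ι), MapsVec M V (U + z • V) → MapsVec M U (z • U) → U = 0

theorem memℓp_restrict {ι κ : Type*} (e : κ ↪ ι) (V : EllTwo ι) :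
    Memℓp (fun p : κ => V (e p)) 2 := by
  have h := (memℓp_gen_iff (p := 2) (by norm_num)).1 (lp.memℓp V)
  exact (memℓp_gen_iff (p := 2) (by norm_num)).2 (h.comp_injective e.injective)

/-- Truncation of a vector: keep only the coordinates indexed by `κ`. -/
def truncVec {ι κ : Type*} (e : κ ↪ ι) (V : EllTwo ι) : EllTwo κ :=
  ⟨fun p => V (e p), memℓp_restrict e V⟩

/-- The indices whose harmonic order lies in `I`, among all indices. -/
def harmonicIndex (n : ℕ) (I : Set ℤ) : Fin n × I ↪ Fin n × ℤ :=
  (Function.Embedding.refl _).prodMap (Function.Embedding.subtype _)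

/-- The indices whose harmonic order lies in `I`, among those whose order lies in `J`. -/
def harmonicInclusion (n : ℕ) {I J : Set ℤ} (h : I ⊆ J) : Fin n × I ↪ Fin n × J :=
  (Function.Embedding.refl _).prodMap (Set.embeddingOfSubset I J h)

/-- Truncation of an infinite block matrix: in each block, keep only the rows and columns whose
index lies in `I`. The left, right and two-sided `m`-truncations are those with
`I = Set.Ici (-m)`, `I = Set.Iic m` and `I = Set.Icc (-m) m`. -/
def truncMatrix {n : ℕ} (M : Matrix (Fin n × ℤ) (Fin n × ℤ) ℂ) (I : Set ℤ) :
    Matrix (Fin n × I) (Fin n × I) ℂ :=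
  M.submatrix (harmonicIndex n I) (harmonicIndex n I)

/-- `z` is an eigenvalue of `M`, and for each eigenvector `V` of `M` for `z` the truncation `V'` of
`V` witnesses that `z` is an `ε`-approximate eigenvalue of the truncation `M'` of `M`:
`‖(M' - z) V'‖ < ε ‖V'‖`. -/
def IsApproxEigenvalueByTrunc {ι κ : Type*} (M : Matrix ι ι ℂ) (e : κ ↪ ι) (ε : ℝ) (z : ℂ) : Prop :=
  z ∈ eigenvalueSet M ∧ ∀ V, IsEigenvector M z V →
    ∃ W, MapsVec (M.submatrix e e) (truncVec e V) (W + z • truncVec e V) ∧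
      ‖W‖ < ε * ‖truncVec e V‖

/-- `S ≈ S'` up to `ε`: each point of either set is at distance less than `ε` from a point of the
other one. -/
def SetApprox (ε : ℝ) (S S' : Set ℂ) : Prop :=
  S ⊆ Metric.thickening ε S' ∧ S' ⊆ Metric.thickening ε S

/-- The set `{λ_p + jωk : k ∈ K, p = 1, …, n}`, `ω = 2π/T`. -/
def floquetSet {n : ℕ} (T : ℝ) (lam : Fin n → ℂ) (K : Set ℤ) : Set ℂ :=
  {z | ∃ (p : Fin n) (k : ℤ), k ∈ K ∧ z = lam p + Complex.I * (2 * Real.pi / T : ℝ) * k}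

/-! Write the operator as `B + d`, with `B` bounded on `ℓ²` (in the Fourier basis, multiplication by
the `L^∞` symbol) and `d` the diagonal `-jωk`, which is imaginary and tends to infinity. A
truncation is the compression of `B + d` to a set `J` of coordinates, so all truncations can be
compared inside one Hilbert space.

With `R_J` the compression of `(d - 1)⁻¹`, the eigenvectors of the compression for `z` are the
nonzero fixed vectors of the compact operator `K_J(z) = R_J ((z - 1) - B P_J)` (`compressedPencil`).
By the Fredholm alternative `1 - K_J(z)` is invertible exactly off the eigenvalues. Since `(d -
1)⁻¹` tends to zero, `K_J(z)` and `K_{J'}(z)` are close in norm, uniformly for bounded `z`, as soon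
as `J` and `J'` agree on a large finite set (`exists_finset_norm_compressedPencil_sub_le`). Uniform
bounds on the inverse in one direction, and the maximum principle in the other, then show that the
eigenvalues in a bounded region are close (`exists_finset_compressedEigenvalues_approx`).

Two symmetries make this uniform in `m`: shifting harmonic orders by `k` shifts eigenvalues by
`-jωk`, and, `A` being real, reflecting orders conjugates eigenvalues. Moreover every eigenvalue `z`
of a truncation lies within a fixed distance of some `-jωk` with `k` a retained order
(`exists_bound_truncEigenvalues`). If `k` is far from the edges, the truncation looks near `k` like
the full operator and `z` is close to the Floquet set. If `k` is near the edge `-m`, a shift by `m`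
compares `z` with the finitely many eigenvalues, in a fixed ball, of the truncation to orders `≥ 0`;
these generate `Λ₂⁺(m)`. The edge `m` follows by conjugation.

For the residuals, an eigenvector carries little mass where `d` is far from its eigenvalue, so
cutting there costs little (`HasBoundedPlusDiagonal.isApproxEigenvalueByTrunc`). -/

open Filter Topology

/-! ### Coordinate projections and diagonal operators on `ℓ²`. -/

section EllTwo

variable {ι : Type*}

theorem EllTwo.norm_sq_eq_tsum (V : EllTwo ι) : ‖V‖ ^ 2 = ∑' i, ‖V i‖ ^ 2 := by
  have h := lp.norm_rpow_eq_tsum (p := 2) (by norm_num) V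
  simpa using h

theorem EllTwo.summable_norm_sq (V : EllTwo ι) : Summable fun i => ‖V i‖ ^ 2 := by
  have h := (lp.memℓp V).summable (by norm_num)
  simpa using h

theorem EllTwo.memℓp_of_norm_le {f : ι → ℂ} {c : ℝ} (W : EllTwo ι)
    (h : ∀ i, ‖f i‖ ≤ c * ‖W i‖) : Memℓp f 2 := by
  refine (memℓp_gen_iff (p := 2) (by norm_num)).2 ?_
  have h2 : Summable fun i => c ^ 2 * ‖W i‖ ^ 2 := W.summable_norm_sq.mul_left _
  refine Summable.of_nonneg_of_le (fun i => by positivity) (fun i => ?_) h2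
  have := pow_le_pow_left₀ (norm_nonneg _) (h i) 2
  simpa [mul_pow] using this

theorem EllTwo.norm_le_mul_norm {V W : EllTwo ι} {c : ℝ} (hc : 0 ≤ c)
    (h : ∀ i, ‖V i‖ ≤ c * ‖W i‖) : ‖V‖ ≤ c * ‖W‖ := by
  refine le_of_sq_le_sq ?_ (by positivity)
  rw [mul_pow, V.norm_sq_eq_tsum, W.norm_sq_eq_tsum, ← tsum_mul_left]
  refine V.summable_norm_sq.tsum_le_tsum (fun i => ?_) (W.summable_norm_sq.mul_left _)
  rw [← mul_pow]
  exact pow_le_pow_left₀ (norm_nonneg _) (h i) 2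

/-- Multiplication by a bounded family, as an operator on `ℓ²(ι)`. -/
noncomputable def diagOp (f : ι → ℂ) (C : ℝ) (hC : 0 ≤ C) (hf : ∀ i, ‖f i‖ ≤ C) :
    EllTwo ι →L[ℂ] EllTwo ι :=
  have hle (V : EllTwo ι) (i : ι) : ‖f i * V i‖ ≤ C * ‖V i‖ := by
    rw [norm_mul]; exact mul_le_mul_of_nonneg_right (hf i) (norm_nonneg _)
  LinearMap.mkContinuous
    { toFun := fun V => ⟨fun i => f i * V i, EllTwo.memℓp_of_norm_le V (hle V)⟩
      map_add' := fun V W => by ext i; exact mul_add _ _ _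
      map_smul' := fun c V => by ext i; exact mul_left_comm _ _ _ }
    C (fun V => EllTwo.norm_le_mul_norm hC (hle V))

@[simp] theorem diagOp_apply (f : ι → ℂ) (C : ℝ) (hC : 0 ≤ C) (hf : ∀ i, ‖f i‖ ≤ C)
    (V : EllTwo ι) (i : ι) : diagOp f C hC hf V i = f i * V i := rfl

open Classical in
/-- The orthogonal projection of `ℓ²(ι)` onto the families supported in `J`. -/
noncomputable def coordProj (J : Set ι) : EllTwo ι →L[ℂ] EllTwo ι :=
  diagOp (fun i => if i ∈ J then 1 else 0) 1 zero_le_one (fun i => by split_ifs <;> simp)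

open Classical in
@[simp] theorem coordProj_apply (J : Set ι) (V : EllTwo ι) (i : ι) :
    coordProj J V i = if i ∈ J then V i else 0 := by
  simp [coordProj]

theorem norm_coordProj_le (J : Set ι) (V : EllTwo ι) : ‖coordProj J V‖ ≤ ‖V‖ := by
  classical
  rw [← one_mul ‖V‖]
  refine EllTwo.norm_le_mul_norm zero_le_one (fun i => ?_)
  rw [coordProj_apply]; split_ifs <;> simp

theorem sum_single_add_coordProj_compl [DecidableEq ι] (F : Finset ι) (W : EllTwo ι) :
    ∑ i ∈ F, lp.single 2 i (W i) + coordProj (F : Set ι)ᶜ W = W := by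
  ext i
  rw [lp.coeFn_add, Pi.add_apply, lp.coeFn_sum, Finset.sum_apply, coordProj_apply]
  by_cases hi : i ∈ F
  · rw [Finset.sum_eq_single i]
    · simp [hi]
    · intro j _ hj; simp [lp.single_apply, hj.symm]
    · simp [hi]
  · rw [Finset.sum_eq_zero]
    · simp [hi]
    · intro j hj
      have : i ≠ j := fun h => hi (h ▸ hj)
      simp [lp.single_apply, this]

theorem norm_le_sum_add_norm_coordProj_compl (F : Finset ι) (W : EllTwo ι) :
    ‖W‖ ≤ ∑ i ∈ F, ‖W i‖ + ‖coordProj (F : Set ι)ᶜ W‖ := by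
  classical
  have h1 : ‖∑ i ∈ F, lp.single (E := fun _ : ι => ℂ) 2 i (W i)‖ ≤ ∑ i ∈ F, ‖W i‖ :=
    (norm_sum_le _ _).trans (Finset.sum_le_sum fun i _ => (lp.norm_single (by norm_num) i _).le)
  calc ‖W‖ = ‖∑ i ∈ F, lp.single 2 i (W i) + coordProj (F : Set ι)ᶜ W‖ := by
        rw [sum_single_add_coordProj_compl]
    _ ≤ _ := (norm_add_le _ _).trans (add_le_add_left h1 _)

theorem tendsto_coordProj_compl (V : EllTwo ι) :
    Tendsto (fun F : Finset ι => coordProj (F : Set ι)ᶜ V) atTop (𝓝 0) := by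
  classical
  have h := lp.hasSum_single (p := 2) (by norm_num) V
  have h2 : Tendsto (fun F : Finset ι => V - ∑ i ∈ F, lp.single 2 i (V i)) atTop (𝓝 (V - V)) :=
    tendsto_const_nhds.sub h
  rw [sub_self] at h2
  refine h2.congr (fun F => ?_)
  rw [sub_eq_iff_eq_add', sum_single_add_coordProj_compl]

/-- A bounded functional is small on families supported off a large finite set. -/
theorem exists_finset_norm_apply_coordProj_compl_le (φ : EllTwo ι →L[ℂ] ℂ) {η : ℝ} (hη : 0 < η) :
    ∃ F : Finset ι, ∀ G : Finset ι, F ⊆ G → ∀ V,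
      ‖φ (coordProj (G : Set ι)ᶜ V)‖ ≤ η * ‖V‖ := by
  classical
  -- The Riesz representative of `φ` has small tails; the self-adjoint projection is moved onto it.
  set v := (InnerProductSpace.toDual ℂ (EllTwo ι)).symm φ with hv
  have h := (tendsto_coordProj_compl v).norm
  rw [norm_zero] at h
  obtain ⟨F, hF⟩ := eventually_atTop.1 (h.eventually (eventually_le_nhds hη))
  refine ⟨F, fun G hG V => ?_⟩
  have h1 : φ (coordProj (G : Set ι)ᶜ V) = inner ℂ v (coordProj (G : Set ι)ᶜ V) := by
    rw [hv, InnerProductSpace.toDual_symm_apply]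
  have h2 : inner ℂ v (coordProj (G : Set ι)ᶜ V) = inner ℂ (coordProj (G : Set ι)ᶜ v) V := by
    rw [lp.inner_eq_tsum, lp.inner_eq_tsum]
    refine tsum_congr (fun i => ?_)
    simp only [coordProj_apply]
    split_ifs <;> simp
  rw [h1, h2]
  exact (norm_inner_le_norm _ _).trans (mul_le_mul_of_nonneg_right (hF G hG) (norm_nonneg _))

/-- Multiplication by a family tending to zero is a compact operator. -/
theorem isCompactOperator_diagOp {f : ι → ℂ} {C : ℝ} {hC : 0 ≤ C} {hf : ∀ i, ‖f i‖ ≤ C}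
    (h0 : Tendsto f cofinite (𝓝 0)) : IsCompactOperator (diagOp f C hC hf) := by
  classical
  -- Finite-rank cut-offs; they converge in operator norm because the discarded diagonal entries are
  -- uniformly small.
  let S (F : Finset ι) : EllTwo ι →L[ℂ] EllTwo ι :=
    ∑ i ∈ F, (lp.singleContinuousLinearMap ℂ (fun _ : ι => ℂ) 2 i) ∘L
      (f i • lp.evalCLM ℂ (fun _ : ι => ℂ) 2 i)
  have hS (F : Finset ι) (V : EllTwo ι) (i : ι) :
      S F V i = if i ∈ F then f i * V i else 0 := by
    simp only [S, sum_apply, lp.coeFn_sum, Finset.sum_apply,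
      ContinuousLinearMap.comp_apply, lp.singleContinuousLinearMap_apply,
      lp.single_apply, Pi.single_apply]
    rw [Finset.sum_ite_eq]
    rfl
  refine isCompactOperator_of_tendsto (l := atTop) (F := S) ?_ (Eventually.of_forall fun F => ?_)
  · rw [tendsto_iff_norm_sub_tendsto_zero, Metric.tendsto_atTop]
    intro ε hε
    have hfin : {i | ¬ ‖f i‖ < ε / 2}.Finite := by
      have := h0.norm
      rw [norm_zero] at this
      exact this.eventually (gt_mem_nhds (half_pos hε))
    refine ⟨hfin.toFinset, fun G hG => ?_⟩
    rw [dist_zero_right, norm_norm]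
    refine lt_of_le_of_lt (ContinuousLinearMap.opNorm_le_bound _ (half_pos hε).le fun V => ?_)
      (half_lt_self hε)
    refine EllTwo.norm_le_mul_norm (half_pos hε).le (fun i => ?_)
    rw [sub_apply, lp.coeFn_sub, Pi.sub_apply, hS, diagOp_apply]
    split_ifs with hi
    · simp only [sub_self, norm_zero]; positivity
    · rw [zero_sub, norm_neg, norm_mul]
      refine mul_le_mul_of_nonneg_right ?_ (norm_nonneg _)
      by_contra hcon
      exact hi (hG (by simpa using (not_le.1 hcon).le))
  · have : S F ∈ (compactOperator (RingHom.id ℂ) (EllTwo ι) (EllTwo ι)) := by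
      refine Submodule.sum_mem _ (fun i _ => ?_)
      have h1 : IsCompactOperator (f i • lp.evalCLM ℂ (fun _ : ι => ℂ) 2 i) :=
        isCompactOperator_of_locallyCompactSpace_dom (f i • lp.evalCLM ℂ (fun _ : ι => ℂ) 2 i)
      exact h1.clm_comp (lp.singleContinuousLinearMap ℂ (fun _ : ι => ℂ) 2 i)
    exact this

end EllTwo

/-! ### Discreteness of the nonzero eigenvalues of a compact operator. -/

open Module.End in
/-- The eigenvalues of a compact operator on a Hilbert space accumulate only at zero. -/
theorem IsCompactOperator.finite_setOf_hasEigenvalue {E : Type*} [NormedAddCommGroup E]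
    [InnerProductSpace ℂ E] {C : E →L[ℂ] E} (hC : IsCompactOperator C) {c : ℝ} (hc : 0 < c) :
    {μ : ℂ | HasEigenvalue (C : E →ₗ[ℂ] E) μ ∧ c ≤ ‖μ‖}.Finite := by
  by_contra hinf
  let μ := Set.Infinite.natEmbedding _ hinf
  have hμ (n : ℕ) : HasEigenvalue (C : E →ₗ[ℂ] E) (μ n : ℂ) := (μ n).2.1
  choose v hv using fun n => (hμ n).exists_hasEigenvector
  have hli : LinearIndependent ℂ v :=
    eigenvectors_linearIndependent' (C : E →ₗ[ℂ] E) (fun n => (μ n : ℂ))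
      (Subtype.val_injective.comp μ.injective) v hv
  set e := InnerProductSpace.gramSchmidtNormed ℂ v with he
  have hon : Orthonormal ℂ e := InnerProductSpace.gramSchmidtNormed_orthonormal hli
  have hIic (n : ℕ) : Submodule.span ℂ (e '' Set.Iic n) = Submodule.span ℂ (v '' Set.Iic n) := by
    rw [he, InnerProductSpace.span_gramSchmidtNormed, InnerProductSpace.span_gramSchmidt_Iic]
  have hIio (n : ℕ) : Submodule.span ℂ (e '' Set.Iio n) = Submodule.span ℂ (v '' Set.Iio n) := by
    rw [he, InnerProductSpace.span_gramSchmidtNormed, InnerProductSpace.span_gramSchmidt_Iio]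
  have heigen (n : ℕ) : C (v n) = (μ n : ℂ) • v n := (hv n).apply_eq_smul
  have hsub (n : ℕ) : ∀ x ∈ Submodule.span ℂ (v '' Set.Iic n),
      C x - (μ n : ℂ) • x ∈ Submodule.span ℂ (v '' Set.Iio n) := by
    intro x hx
    induction hx using Submodule.span_induction with
    | mem x hx =>
      obtain ⟨k, hk, rfl⟩ := hx
      rw [heigen, ← sub_smul]
      rcases eq_or_lt_of_le (Set.mem_Iic.1 hk) with rfl | hlt
      · simp
      · exact Submodule.smul_mem _ _ (Submodule.subset_span ⟨k, hlt, rfl⟩)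
    | zero => simp
    | add x y _ _ hx hy =>
      have : C (x + y) - (μ n : ℂ) • (x + y) =
        (C x - (μ n : ℂ) • x) + (C y - (μ n : ℂ) • y) := by rw [map_add, smul_add]; abel
      rw [this]; exact Submodule.add_mem _ hx hy
    | smul a x _ hx =>
      have : C (a • x) - (μ n : ℂ) • (a • x) = a • (C x - (μ n : ℂ) • x) := by
        rw [map_smul, smul_sub, smul_comm]
      rw [this]; exact Submodule.smul_mem _ _ hx
  have horth (n : ℕ) : ∀ x ∈ Submodule.span ℂ (v '' Set.Iio n), inner ℂ (e n) x = 0 := by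
    intro x hx
    rw [← hIio] at hx
    induction hx using Submodule.span_induction with
    | mem x hx =>
      obtain ⟨k, hk, rfl⟩ := hx
      exact hon.2 (ne_of_gt hk)
    | zero => simp
    | add x y _ _ hx hy => rw [inner_add_right, hx, hy, add_zero]
    | smul a x _ hx => rw [inner_smul_right, hx, mul_zero]
  have hmem (n : ℕ) : e n ∈ Submodule.span ℂ (v '' Set.Iic n) := by
    rw [← hIic]; exact Submodule.subset_span ⟨n, Set.mem_Iic.2 le_rfl, rfl⟩
  -- Along `e n` the vector `C (e n) - C (e m)` has component exactly `μ n`, everything else lying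
  -- in the span of the earlier eigenvectors. So `C` sends an orthonormal sequence to a
  -- `c`-separated one, which compactness forbids.
  have hdist {m n : ℕ} (hmn : m < n) : c ≤ ‖C (e n) - C (e m)‖ := by
    have hIicIio : Submodule.span ℂ (v '' Set.Iic m) ≤ Submodule.span ℂ (v '' Set.Iio n) :=
      Submodule.span_mono (Set.image_mono fun k hk => lt_of_le_of_lt hk hmn)
    have hIioIio : Submodule.span ℂ (v '' Set.Iio m) ≤ Submodule.span ℂ (v '' Set.Iio n) :=
      Submodule.span_mono (Set.image_mono fun k hk => lt_trans hk hmn)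
    have h1 : (C (e n) - (μ n : ℂ) • e n) - (C (e m) - (μ m : ℂ) • e m) - (μ m : ℂ) • e m ∈
        Submodule.span ℂ (v '' Set.Iio n) :=
      Submodule.sub_mem _ (Submodule.sub_mem _ (hsub n _ (hmem n)) (hIioIio (hsub m _ (hmem m))))
        (Submodule.smul_mem _ _ (hIicIio (hmem m)))
    have h2 : inner ℂ (e n) (C (e n) - C (e m)) = (μ n : ℂ) := by
      have h3 : C (e n) - C (e m) = (μ n : ℂ) • e n +
        ((C (e n) - (μ n : ℂ) • e n) - (C (e m) - (μ m : ℂ) • e m) - (μ m : ℂ) • e m) := by abel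
      rw [h3, inner_add_right, horth n _ h1, inner_smul_right,
        inner_self_eq_norm_sq_to_K, hon.1 n]
      simp
    calc c ≤ ‖(μ n : ℂ)‖ := (μ n).2.2
      _ = ‖inner ℂ (e n) (C (e n) - C (e m))‖ := by rw [h2]
      _ ≤ ‖e n‖ * ‖C (e n) - C (e m)‖ := norm_inner_le_norm _ _
      _ = _ := by rw [hon.1 n, one_mul]
  obtain ⟨K, hK, hK'⟩ := hC.image_closedBall_subset_compact 1
  obtain ⟨y, -, ψ, hψ, hψy⟩ := hK.tendsto_subseq (fun n => hK' ⟨e n, by simp [hon.1 n], rfl⟩)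
  obtain ⟨N, hN⟩ := Metric.cauchySeq_iff'.1 hψy.cauchySeq c hc
  have := hN (N + 1) (Nat.le_succ N)
  rw [dist_eq_norm] at this
  exact absurd (hdist (hψ (Nat.lt_succ_self N))) (not_le.2 this)

/-! ### Compressions of a bounded perturbation of an imaginary diagonal. -/

section PerturbedDiagonal

variable {ι : Type*}

/-- `V` is an eigenvector, for the eigenvalue `z`, of the compression to the coordinates in `J` of
the sum of the bounded operator `B` and of the diagonal operator `d`. -/
def IsCompressedEigenvector (B : EllTwo ι →L[ℂ] EllTwo ι) (d : ι → ℂ) (J : Set ι) (z : ℂ)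
    (V : EllTwo ι) : Prop :=
  V ≠ 0 ∧ (∀ i ∉ J, V i = 0) ∧ ∀ i ∈ J, B V i + d i * V i = z * V i

/-- The eigenvalues of the compression of `B + d` to the coordinates in `J`. -/
def compressedEigenvalues (B : EllTwo ι →L[ℂ] EllTwo ι) (d : ι → ℂ) (J : Set ι) : Set ℂ :=
  {z | ∃ V, IsCompressedEigenvector B d J z V}

variable {B : EllTwo ι →L[ℂ] EllTwo ι} {d : ι → ℂ} {J : Set ι}

/-- Makes `1` a convenient base point: it lies in the resolvent set of any imaginary diagonal, with
resolvent of norm at most `1`. -/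
theorem one_le_norm_sub_one {w : ℂ} (hw : w.re = 0) : 1 ≤ ‖w - 1‖ := by
  have := Complex.abs_re_le_norm (w - 1)
  simpa [hw] using this

theorem norm_inv_sub_one_le {w : ℂ} (hw : w.re = 0) : ‖(w - 1)⁻¹‖ ≤ 1 := by
  rw [norm_inv]; exact inv_le_one_of_one_le₀ (one_le_norm_sub_one hw)

theorem sub_one_ne_zero_of_re_eq_zero {w : ℂ} (hw : w.re = 0) : w - 1 ≠ 0 :=
  norm_pos_iff.1 (zero_lt_one.trans_le (one_le_norm_sub_one hw))

open Classical in
/-- The resolvent at `1` of the imaginary diagonal `d`, compressed to the coordinates in `J`. -/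
noncomputable def diagResolvent (hd : ∀ i, (d i).re = 0) (J : Set ι) : EllTwo ι →L[ℂ] EllTwo ι :=
  diagOp (fun i => if i ∈ J then (d i - 1)⁻¹ else 0) 1 zero_le_one (fun i => by
    split_ifs
    · exact norm_inv_sub_one_le (hd i)
    · simp)

open Classical in
theorem diagResolvent_apply (hd : ∀ i, (d i).re = 0) (J : Set ι) (V : EllTwo ι) (i : ι) :
    diagResolvent hd J V i = if i ∈ J then (d i - 1)⁻¹ * V i else 0 := by
  simp [diagResolvent]

theorem tendsto_inv_sub_one (hd' : Tendsto (fun i => ‖d i‖) cofinite atTop) :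
    Tendsto (fun i => (d i - 1)⁻¹) cofinite (𝓝 0) := by
  refine tendsto_inv₀_cobounded.comp ?_
  rw [← tendsto_norm_atTop_iff_cobounded]
  refine tendsto_atTop_mono (fun i => ?_) (tendsto_atTop_add_const_right _ (-1 : ℝ) hd')
  have := norm_sub_norm_le (d i) 1
  simpa [sub_eq_add_neg] using this

theorem isCompactOperator_diagResolvent (hd : ∀ i, (d i).re = 0)
    (hd' : Tendsto (fun i => ‖d i‖) cofinite atTop) (J : Set ι) :
    IsCompactOperator (diagResolvent hd J) := by
  classical
  refine isCompactOperator_diagOp ?_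
  have h0 := (tendsto_inv_sub_one hd').norm
  rw [norm_zero] at h0
  refine squeeze_zero_norm (fun i => ?_) h0
  split_ifs
  · exact le_rfl
  · simp

/-- The operator whose fixed vectors are the eigenvectors for `z` of the compression of `B + d`
to the coordinates in `J`. -/
noncomputable def compressedPencil (B : EllTwo ι →L[ℂ] EllTwo ι) (hd : ∀ i, (d i).re = 0)
    (J : Set ι) (z : ℂ) : EllTwo ι →L[ℂ] EllTwo ι :=
  diagResolvent hd J ∘L ((z - 1) • 1 - B ∘L coordProj J)

theorem compressedPencil_apply (hd : ∀ i, (d i).re = 0) (z : ℂ) (V : EllTwo ι) :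
    compressedPencil B hd J z V = diagResolvent hd J ((z - 1) • V - B (coordProj J V)) := rfl

theorem coordProj_eq_self {V : EllTwo ι} (h : ∀ i ∉ J, V i = 0) : coordProj J V = V := by
  classical
  ext i
  rw [coordProj_apply]
  split_ifs with hi
  · rfl
  · exact (h i hi).symm

theorem isCompactOperator_compressedPencil (hd : ∀ i, (d i).re = 0)
    (hd' : Tendsto (fun i => ‖d i‖) cofinite atTop) (z : ℂ) :
    IsCompactOperator (compressedPencil B hd J z) :=
  (isCompactOperator_diagResolvent hd hd' J).comp_clm _

/-- On `J` the eigenvalue equation reads `(d - 1) V = (z - 1) V - B V`, and `d - 1` can be divided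
out; off `J` the compressed resolvent vanishes, which forces the support condition. -/
theorem isCompressedEigenvector_iff (hd : ∀ i, (d i).re = 0) {z : ℂ} {V : EllTwo ι} :
    IsCompressedEigenvector B d J z V ↔ V ≠ 0 ∧ compressedPencil B hd J z V = V := by
  classical
  refine and_congr_right fun _ => ⟨fun ⟨h0, h1⟩ => ?_, fun h => ?_⟩
  · ext i
    rw [compressedPencil_apply, coordProj_eq_self h0, diagResolvent_apply]
    split_ifs with hi
    · rw [inv_mul_eq_iff_eq_mul₀ (sub_one_ne_zero_of_re_eq_zero (hd i))]
      have := h1 i hi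
      simp only [lp.coeFn_sub, lp.coeFn_smul, Pi.sub_apply, Pi.smul_apply, smul_eq_mul]
      linear_combination -this
    · exact (h0 i hi).symm
  · have h0 : ∀ i ∉ J, V i = 0 := fun i hi => by
      rw [← h, compressedPencil_apply, diagResolvent_apply, if_neg hi]
    refine ⟨h0, fun i hi => ?_⟩
    have h2 := congrArg (fun W : EllTwo ι => W i) h
    simp only [compressedPencil_apply, coordProj_eq_self h0, diagResolvent_apply, if_pos hi] at h2
    rw [inv_mul_eq_iff_eq_mul₀ (sub_one_ne_zero_of_re_eq_zero (hd i))] at h2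
    simp only [lp.coeFn_sub, lp.coeFn_smul, Pi.sub_apply, Pi.smul_apply, smul_eq_mul] at h2
    linear_combination -h2

/-- Fredholm alternative for the compact pencil at the value `1`. -/
theorem isUnit_one_sub_compressedPencil_iff (hd : ∀ i, (d i).re = 0)
    (hd' : Tendsto (fun i => ‖d i‖) cofinite atTop) {z : ℂ} :
    IsUnit (1 - compressedPencil B hd J z) ↔ z ∉ compressedEigenvalues B d J := by
  refine ⟨fun hu ⟨V, hV⟩ => ?_, fun hz => ?_⟩
  · obtain ⟨hV0, hV1⟩ := (isCompressedEigenvector_iff hd).1 hV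
    obtain ⟨u, hu⟩ := hu
    have h1 : (u : EllTwo ι →L[ℂ] EllTwo ι) V = 0 := by
      rw [hu]; simp [hV1]
    have h2 : ((↑u⁻¹ : EllTwo ι →L[ℂ] EllTwo ι) * u) V = V := by rw [u.inv_mul]; rfl
    exact hV0 (by rw [← h2, mul_apply_eq_comp, h1, map_zero])
  · rcases (isCompactOperator_compressedPencil (B := B) (J := J) hd hd' z).hasEigenvalue_or_mem_resolventSet
      one_ne_zero with h | h
    · obtain ⟨V, hV⟩ := h.exists_hasEigenvector
      refine absurd ⟨V, (isCompressedEigenvector_iff hd).2 ⟨hV.2, ?_⟩⟩ hz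
      simpa using hV.apply_eq_smul
    · rw [spectrum.mem_resolventSet_iff, map_one] at h
      exact h

/-- An eigenvalue of a compression is at distance at most `‖B‖` from the diagonal. -/
theorem IsCompressedEigenvector.exists_norm_sub_lt {z : ℂ} {V : EllTwo ι}
    (h : IsCompressedEigenvector B d J z V) {C : ℝ} (hC : ‖B‖ < C) : ∃ i ∈ J, ‖z - d i‖ < C := by
  classical
  by_contra! hcon
  obtain ⟨hV, h0, h1⟩ := h
  have hC0 : 0 < C := (norm_nonneg B).trans_lt hC
  have hle : ‖V‖ ≤ C⁻¹ * ‖B V‖ := by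
    refine EllTwo.norm_le_mul_norm (by positivity) (fun i => ?_)
    by_cases hi : i ∈ J
    · have h2 : B V i = (z - d i) * V i := by linear_combination h1 i hi
      rw [h2, norm_mul, ← mul_assoc]
      refine le_mul_of_one_le_left (norm_nonneg _) ?_
      rw [inv_mul_eq_div, one_le_div hC0]
      exact hcon i hi
    · rw [h0 i hi, norm_zero]; positivity
  have hVpos : 0 < ‖V‖ := norm_pos_iff.2 hV
  have h3 : C * ‖V‖ ≤ ‖B‖ * ‖V‖ := by
    refine le_trans ?_ (B.le_opNorm V)
    rwa [inv_mul_eq_div, le_div_iff₀ hC0, mul_comm] at hle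
  exact absurd (le_of_mul_le_mul_right h3 hVpos) (not_le.2 hC)

/-- An eigenvector of a compression is small on the coordinates where the diagonal is far from the
eigenvalue. -/
theorem IsCompressedEigenvector.norm_coordProj_le {z : ℂ} {V : EllTwo ι}
    (h : IsCompressedEigenvector B d J z V) {S : Set ι} {c : ℝ} (hc : 0 < c)
    (hS : ∀ i ∈ S, i ∈ J → c ≤ ‖z - d i‖) : ‖coordProj S V‖ ≤ c⁻¹ * ‖B‖ * ‖V‖ := by
  classical
  obtain ⟨-, h0, h1⟩ := h
  rw [mul_assoc]
  refine le_trans ?_ (mul_le_mul_of_nonneg_left (B.le_opNorm V) (by positivity))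
  refine EllTwo.norm_le_mul_norm (by positivity) (fun i => ?_)
  rw [coordProj_apply]
  split_ifs with hi
  · by_cases hiJ : i ∈ J
    · have h2 : B V i = (z - d i) * V i := by linear_combination h1 i hiJ
      rw [h2, norm_mul, ← mul_assoc]
      refine le_mul_of_one_le_left (norm_nonneg _) ?_
      rw [inv_mul_eq_div, one_le_div hc]
      exact hS i hi hiJ
    · rw [h0 i hiJ, norm_zero]; positivity
  · rw [norm_zero]; positivity

theorem compressedPencil_sub_compressedPencil (hd : ∀ i, (d i).re = 0) (z w : ℂ) (V : EllTwo ι) :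
    compressedPencil B hd J z V - compressedPencil B hd J w V =
      (z - w) • diagResolvent hd J V := by
  rw [compressedPencil_apply, compressedPencil_apply, ← map_sub, ← map_smul]
  congr 1
  module

/-- The eigenvalues of a compression have no finite accumulation point. -/
theorem finite_compressedEigenvalues_inter_closedBall (hd : ∀ i, (d i).re = 0)
    (hd' : Tendsto (fun i => ‖d i‖) cofinite atTop) (R : ℝ) :
    (compressedEigenvalues B d J ∩ Metric.closedBall 0 R).Finite := by
  -- A real point at distance at least `‖B‖ + 1` from the imaginary diagonal, hence out of reach of
  -- the eigenvalues.
  set z₀ : ℂ := ((‖B‖ + 1 : ℝ) : ℂ) with hz₀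
  have hz₀' : z₀ ∉ compressedEigenvalues B d J := by
    rintro ⟨V, hV⟩
    obtain ⟨i, -, hi⟩ := hV.exists_norm_sub_lt (lt_add_one ‖B‖)
    have h2 := Complex.abs_re_le_norm (z₀ - d i)
    rw [Complex.sub_re, hd, hz₀, Complex.ofReal_re, sub_zero] at h2
    exact absurd ((le_abs_self _).trans h2) (not_le.2 hi)
  obtain ⟨u, hu⟩ := (isUnit_one_sub_compressedPencil_iff hd hd').2 hz₀'
  -- The pencil is affine in `z` with slope `diagResolvent hd J`, so an eigenvalue `z` gives the
  -- eigenvalue `(z - z₀)⁻¹` of this compact operator. In a bounded region these reciprocals stay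
  -- away from zero, hence are finite in number.
  set C : EllTwo ι →L[ℂ] EllTwo ι := (↑u⁻¹ : EllTwo ι →L[ℂ] EllTwo ι) ∘L diagResolvent hd J with hC
  have hCc : IsCompactOperator C := (isCompactOperator_diagResolvent hd hd' J).clm_comp _
  have hpos : 0 < (|R| + ‖z₀‖ + 1)⁻¹ := by positivity
  refine Set.Finite.of_finite_image (f := fun z => (z - z₀)⁻¹)
    ((hCc.finite_setOf_hasEigenvalue hpos).subset ?_) ?_
  · rintro _ ⟨z, ⟨⟨V, hV⟩, hzR⟩, rfl⟩
    have hne : z ≠ z₀ := fun h => hz₀' (h ▸ ⟨V, hV⟩)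
    have hne' : z - z₀ ≠ 0 := sub_ne_zero.2 hne
    obtain ⟨hV0, hV1⟩ := (isCompressedEigenvector_iff hd).1 hV
    refine ⟨?_, ?_⟩
    · refine Module.End.hasEigenvalue_of_hasEigenvector (x := V)
        ⟨Module.End.mem_eigenspace_iff.2 ?_, hV0⟩
      have h1 : (u : EllTwo ι →L[ℂ] EllTwo ι) V = (z - z₀) • diagResolvent hd J V := by
        rw [hu, ← compressedPencil_sub_compressedPencil (B := B) hd z z₀ V, hV1]; simp
      have h2 : ((↑u⁻¹ : EllTwo ι →L[ℂ] EllTwo ι) * u) V = V := by rw [u.inv_mul]; rfl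
      rw [mul_apply_eq_comp, h1, map_smul] at h2
      rw [eq_inv_smul_iff₀ hne']
      exact h2
    · rw [norm_inv]
      refine inv_anti₀ (norm_pos_iff.2 hne') ?_
      have : ‖z‖ ≤ R := by simpa using hzR
      have := norm_sub_le z z₀
      have := le_abs_self R
      linarith
  · intro z _ w _ h
    simpa using h

/-! ### Norm dependence of the pencil on the set of coordinates. -/

theorem exists_finset_norm_inv_sub_one_le (hd' : Tendsto (fun i => ‖d i‖) cofinite atTop) {η : ℝ}
    (hη : 0 < η) : ∃ F : Finset ι, ∀ i ∉ F, ‖(d i - 1)⁻¹‖ ≤ η := by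
  have h0 := (tendsto_inv_sub_one hd').norm
  rw [norm_zero] at h0
  have hfin : {i | ¬ ‖(d i - 1)⁻¹‖ < η}.Finite := h0.eventually (gt_mem_nhds hη)
  refine ⟨hfin.toFinset, fun i hi => ?_⟩
  simp only [Set.Finite.mem_toFinset, Set.mem_ofPred_eq, not_not] at hi
  exact hi.le

/-- The two diagonals agree on `F`, and off `F` they differ at most by an entry of the resolvent,
which is small there. -/
theorem exists_finset_norm_diagResolvent_sub_le (hd : ∀ i, (d i).re = 0)
    (hd' : Tendsto (fun i => ‖d i‖) cofinite atTop) {η : ℝ} (hη : 0 < η) :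
    ∃ F : Finset ι, ∀ J J' : Set ι, (∀ i ∈ F, i ∈ J ↔ i ∈ J') → ∀ W,
      ‖diagResolvent hd J W - diagResolvent hd J' W‖ ≤ η * ‖W‖ := by
  classical
  obtain ⟨F, hF⟩ := exists_finset_norm_inv_sub_one_le hd' hη
  refine ⟨F, fun J J' hJ W => EllTwo.norm_le_mul_norm hη.le (fun i => ?_)⟩
  rw [lp.coeFn_sub, Pi.sub_apply, diagResolvent_apply, diagResolvent_apply]
  have h0 : 0 ≤ η * ‖W i‖ := by positivity
  by_cases hi : i ∈ F
  · simp only [hJ i hi, sub_self, norm_zero]; exact h0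
  · have h1 : ‖(d i - 1)⁻¹ * W i‖ ≤ η * ‖W i‖ := by
      rw [norm_mul]; exact mul_le_mul_of_nonneg_right (hF i hi) (norm_nonneg _)
    split_ifs
    · rwa [sub_self, norm_zero]
    · rwa [sub_zero]
    · rwa [zero_sub, norm_neg]
    · rwa [sub_self, norm_zero]

/-- Composed with the compact resolvent of `d`, a bounded operator is uniformly small on families
supported off a large finite set. -/
theorem exists_finset_norm_diagResolvent_comp_le (B : EllTwo ι →L[ℂ] EllTwo ι)
    (hd : ∀ i, (d i).re = 0) (hd' : Tendsto (fun i => ‖d i‖) cofinite atTop) {η : ℝ} (hη : 0 < η) :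
    ∃ F : Finset ι, ∀ (J : Set ι) (U : EllTwo ι), (∀ i ∈ F, U i = 0) →
      ‖diagResolvent hd J (B U)‖ ≤ η * ‖U‖ := by
  classical
  have hb : 0 < ‖B‖ + 1 := by positivity
  have hη' : 0 < η / 2 / (‖B‖ + 1) := by positivity
  obtain ⟨F₀, hF₀⟩ := exists_finset_norm_inv_sub_one_le hd' hη'
  have hc : (0 : ℝ) < F₀.card + 1 := by positivity
  have hδ : 0 < η / 2 / (F₀.card + 1) := by positivity
  -- Outside `F₀` the resolvent is already small. Each of the finitely many remaining rows of `B` is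
  -- a bounded functional, small off a finite set; dividing by `F₀.card + 1` lets these rows add up
  -- to at most `η / 2`.
  choose Fi hFi using fun i : ι => exists_finset_norm_apply_coordProj_compl_le
    (lp.evalCLM ℂ (fun _ : ι => ℂ) 2 i ∘L B) hδ
  refine ⟨F₀.biUnion Fi, fun J U hU => ?_⟩
  have hUF : coordProj (F₀.biUnion Fi : Set ι)ᶜ U = U :=
    coordProj_eq_self fun i hi => hU i (by simpa using hi)
  have hrow : ∀ i ∈ F₀, ‖B U i‖ ≤ η / 2 / (F₀.card + 1) * ‖U‖ := fun i hi => by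
    have := hFi i _ (Finset.subset_biUnion_of_mem Fi hi) U
    rwa [hUF] at this
  have hA : ∑ i ∈ F₀, ‖diagResolvent hd J (B U) i‖ ≤ η / 2 * ‖U‖ := by
    have : ∀ i ∈ F₀, ‖diagResolvent hd J (B U) i‖ ≤ η / 2 / (F₀.card + 1) * ‖U‖ := fun i hi => by
      refine le_trans ?_ (hrow i hi)
      rw [diagResolvent_apply]
      split_ifs
      · rw [norm_mul]
        exact mul_le_of_le_one_left (norm_nonneg _) (norm_inv_sub_one_le (hd i))
      · rw [norm_zero]; exact norm_nonneg _
    refine (Finset.sum_le_card_nsmul _ _ _ this).trans ?_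
    rw [nsmul_eq_mul, ← mul_assoc, mul_div_assoc']
    refine mul_le_mul_of_nonneg_right ?_ (norm_nonneg _)
    rw [div_le_iff₀ hc, mul_comm]
    exact mul_le_mul_of_nonneg_left (by linarith) (by positivity)
  have hB : ‖coordProj (F₀ : Set ι)ᶜ (diagResolvent hd J (B U))‖ ≤ η / 2 * ‖U‖ := by
    have e1 : ‖coordProj (F₀ : Set ι)ᶜ (diagResolvent hd J (B U))‖ ≤
        η / 2 / (‖B‖ + 1) * ‖B U‖ := by
      refine EllTwo.norm_le_mul_norm hη'.le (fun i => ?_)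
      have h0 : 0 ≤ η / 2 / (‖B‖ + 1) * ‖B U i‖ := by positivity
      rw [coordProj_apply, diagResolvent_apply]
      split_ifs with hi
      · rw [norm_mul]
        exact mul_le_mul_of_nonneg_right (hF₀ i (by simpa using hi)) (norm_nonneg _)
      · rwa [norm_zero]
      · rwa [norm_zero]
    have e2 : ‖B U‖ ≤ (‖B‖ + 1) * ‖U‖ :=
      (B.le_opNorm U).trans (mul_le_mul_of_nonneg_right (by linarith) (norm_nonneg _))
    refine e1.trans ((mul_le_mul_of_nonneg_left e2 hη'.le).trans (le_of_eq ?_))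
    rw [← mul_assoc, div_mul_cancel₀ _ hb.ne']
  have := norm_le_sum_add_norm_coordProj_compl F₀ (diagResolvent hd J (B U))
  linarith

/-- If two sets of coordinates agree on a large finite set, the corresponding pencils are close. -/
theorem exists_finset_norm_compressedPencil_sub_le (B : EllTwo ι →L[ℂ] EllTwo ι)
    (hd : ∀ i, (d i).re = 0)
    (hd' : Tendsto (fun i => ‖d i‖) cofinite atTop) (R : ℝ) {η : ℝ} (hη : 0 < η) :
    ∃ F : Finset ι, ∀ J J' : Set ι, (∀ i ∈ F, i ∈ J ↔ i ∈ J') → ∀ z : ℂ, ‖z‖ ≤ R → ∀ V,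
      ‖compressedPencil B hd J z V - compressedPencil B hd J' z V‖ ≤ η * ‖V‖ := by
  classical
  have hcpos : 0 < |R| + 1 + ‖B‖ := by positivity
  obtain ⟨F₁, hF₁⟩ := exists_finset_norm_diagResolvent_sub_le hd hd'
    (show 0 < η / 2 / (|R| + 1 + ‖B‖) by positivity)
  obtain ⟨F₂, hF₂⟩ := exists_finset_norm_diagResolvent_comp_le B hd hd' (half_pos hη)
  refine ⟨F₁ ∪ F₂, fun J J' hJ z hz V => ?_⟩
  have hUapp : ∀ i, (coordProj J V - coordProj J' V) i =
      (if i ∈ J then V i else 0) - if i ∈ J' then V i else 0 := fun i => by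
    rw [lp.coeFn_sub, Pi.sub_apply, coordProj_apply, coordProj_apply]
  have hUV : ‖coordProj J V - coordProj J' V‖ ≤ ‖V‖ := by
    rw [← one_mul ‖V‖]
    refine EllTwo.norm_le_mul_norm zero_le_one (fun i => ?_)
    rw [hUapp]
    split_ifs <;> simp
  have hb : ‖(z - 1) • V - B (coordProj J V)‖ ≤ (|R| + 1 + ‖B‖) * ‖V‖ := by
    refine (norm_sub_le _ _).trans ?_
    rw [norm_smul, add_mul]
    refine add_le_add (mul_le_mul_of_nonneg_right ?_ (norm_nonneg _))
      ((B.le_opNorm _).trans (mul_le_mul_of_nonneg_left (norm_coordProj_le J V) (norm_nonneg _)))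
    refine (norm_sub_le z 1).trans (add_le_add (hz.trans (le_abs_self R)) ?_)
    rw [norm_one]
  have h1 := hF₁ J J' (fun i hi => hJ i (Finset.mem_union_left _ hi))
    ((z - 1) • V - B (coordProj J V))
  have h2 := hF₂ J' (coordProj J V - coordProj J' V) (fun i hi => by
    rw [hUapp]; simp only [hJ i (Finset.mem_union_right _ hi), sub_self])
  have h1' := h1.trans (mul_le_mul_of_nonneg_left hb (by positivity))
  rw [← mul_assoc, div_mul_cancel₀ _ hcpos.ne'] at h1'
  have h2' := h2.trans (mul_le_mul_of_nonneg_left hUV (half_pos hη).le)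
  -- The change of the outer resolvent is separated from the change of the inner projection. The
  -- projections do not converge in norm; the second term is small only thanks to the resolvent in
  -- front of `B`.
  have hsplit : compressedPencil B hd J z V - compressedPencil B hd J' z V =
      (diagResolvent hd J ((z - 1) • V - B (coordProj J V)) -
        diagResolvent hd J' ((z - 1) • V - B (coordProj J V))) -
      diagResolvent hd J' (B (coordProj J V - coordProj J' V)) := by
    rw [compressedPencil_apply, compressedPencil_apply]
    simp only [map_sub]
    abel
  rw [hsplit]
  refine (norm_sub_le _ _).trans ?_
  linarith

end PerturbedDiagonal

/-! ### Convergence of the eigenvalues in bounded regions. -/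

section SpectralApproximation

variable {ι : Type*} {B : EllTwo ι →L[ℂ] EllTwo ι} {d : ι → ℂ} {J : Set ι}

theorem differentiable_compressedPencil (hd : ∀ i, (d i).re = 0) :
    Differentiable ℂ (fun z => 1 - compressedPencil B hd J z) := by
  have h : (fun z => 1 - compressedPencil B hd J z) = fun z =>
      (1 + diagResolvent hd J + diagResolvent hd J ∘L (B ∘L coordProj J)) -
        z • diagResolvent hd J := by
    funext z
    ext1 V
    simp only [sub_apply, add_apply, smul_apply,
      ContinuousLinearMap.comp_apply, compressedPencil_apply, map_sub, map_smul, sub_smul, one_smul]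
    abel
  rw [h]
  fun_prop

theorem continuousOn_inverse_compressedPencil (hd : ∀ i, (d i).re = 0) {S : Set ℂ}
    (hS : ∀ z ∈ S, IsUnit (1 - compressedPencil B hd J z)) :
    ContinuousOn (fun z => Ring.inverse (1 - compressedPencil B hd J z)) S := by
  intro z hz
  obtain ⟨u, hu⟩ := hS z hz
  have h1 := NormedRing.inverse_continuousAt u
  rw [hu] at h1
  exact (ContinuousAt.comp (f := fun z => 1 - compressedPencil B hd J z) h1
    (differentiable_compressedPencil hd).continuous.continuousAt).continuousWithinAt

/-- On a compact set free of eigenvalues the inverse of the pencil is uniformly bounded. -/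
theorem exists_norm_le_mul_norm_sub_compressedPencil (hd : ∀ i, (d i).re = 0)
    (hd' : Tendsto (fun i => ‖d i‖) cofinite atTop) {S : Set ℂ} (hS : IsCompact S)
    (hSJ : ∀ z ∈ S, z ∉ compressedEigenvalues B d J) :
    ∃ c > 0, ∀ z ∈ S, ∀ V, ‖V‖ ≤ c * ‖V - compressedPencil B hd J z V‖ := by
  have hu : ∀ z ∈ S, IsUnit (1 - compressedPencil B hd J z) := fun z hz =>
    (isUnit_one_sub_compressedPencil_iff hd hd').2 (hSJ z hz)
  obtain ⟨c, hc⟩ := hS.exists_bound_of_continuousOn (continuousOn_inverse_compressedPencil hd hu)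
  refine ⟨|c| + 1, by positivity, fun z hz V => ?_⟩
  have h1 : Ring.inverse (1 - compressedPencil B hd J z) (V - compressedPencil B hd J z V) = V := by
    have := congrArg (fun T : EllTwo ι →L[ℂ] EllTwo ι => T V) (Ring.inverse_mul_cancel _ (hu z hz))
    simpa using this
  calc ‖V‖ = ‖Ring.inverse (1 - compressedPencil B hd J z) (V - compressedPencil B hd J z V)‖ := by
        rw [h1]
    _ ≤ ‖Ring.inverse (1 - compressedPencil B hd J z)‖ * ‖V - compressedPencil B hd J z V‖ :=
        ContinuousLinearMap.le_opNorm _ _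
    _ ≤ _ := mul_le_mul_of_nonneg_right
        ((hc z hz).trans ((le_abs_self c).trans (by linarith))) (norm_nonneg _)

/-- Eigenvalues of compressions in a bounded region do not stray from those of a compression that
agrees with it on a large finite set of coordinates. -/
theorem exists_finset_compressedEigenvalues_subset (hd : ∀ i, (d i).re = 0)
    (hd' : Tendsto (fun i => ‖d i‖) cofinite atTop) (J : Set ι) (R : ℝ) {ε : ℝ} (hε : 0 < ε) :
    ∃ F : Finset ι, ∀ J' : Set ι, (∀ i ∈ F, i ∈ J' ↔ i ∈ J) →
      ∀ z ∈ compressedEigenvalues B d J', ‖z‖ ≤ R →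
        ∃ w ∈ compressedEigenvalues B d J, dist z w < ε := by
  -- On this compact set the inverse of the pencil of `J` is bounded by some `c`; a perturbation of
  -- norm at most `(2 * c)⁻¹` then admits no nonzero fixed vector.
  set S := Metric.closedBall (0 : ℂ) R \ Metric.thickening ε (compressedEigenvalues B d J) with hS
  have hScomp : IsCompact S :=
    (isCompact_closedBall 0 R).diff Metric.isOpen_thickening
  obtain ⟨c, hc, hcS⟩ := exists_norm_le_mul_norm_sub_compressedPencil (B := B) (J := J) hd hd' hScomp
    (fun z hz hzJ => hz.2 (Metric.self_subset_thickening hε _ hzJ))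
  obtain ⟨F, hF⟩ := exists_finset_norm_compressedPencil_sub_le B hd hd' R
    (show 0 < (2 * c)⁻¹ by positivity)
  refine ⟨F, fun J' hJ' z ⟨V, hV⟩ hzR => ?_⟩
  by_contra! hcon
  have hzS : z ∈ S := ⟨by simpa using hzR, fun h => by
    obtain ⟨w, hw, hzw⟩ := Metric.mem_thickening_iff.1 h
    exact absurd hzw (not_lt.2 (hcon w hw))⟩
  obtain ⟨hV0, hV1⟩ := (isCompressedEigenvector_iff hd).1 hV
  have h1 := hF J' J hJ' z hzR V
  rw [hV1] at h1
  have h2 := (hcS z hzS V).trans (mul_le_mul_of_nonneg_left h1 hc.le)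
  have h3 : c * ((2 * c)⁻¹ * ‖V‖) = ‖V‖ / 2 := by field_simp
  have := norm_pos_iff.2 hV0
  linarith

/-- Each eigenvalue of a compression is close to an eigenvalue of every compression that agrees with
it on a large finite set of coordinates. -/
theorem exists_finset_exists_mem_compressedEigenvalues (hd : ∀ i, (d i).re = 0)
    (hd' : Tendsto (fun i => ‖d i‖) cofinite atTop) {z : ℂ}
    (hz : z ∈ compressedEigenvalues B d J) {ε : ℝ} (hε : 0 < ε) :
    ∃ F : Finset ι, ∀ J' : Set ι, (∀ i ∈ F, i ∈ J' ↔ i ∈ J) →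
      ∃ w ∈ compressedEigenvalues B d J', dist z w < ε := by
  have hfin := finite_compressedEigenvalues_inter_closedBall (B := B) (J := J) hd hd' (‖z‖ + ε)
  -- Only finitely many radii are hit by eigenvalues, so some circle of radius below `ε` about `z`
  -- avoids them all.
  obtain ⟨r, ⟨hr0, hrε⟩, hr⟩ : ∃ r ∈ Set.Ioo 0 ε, r ∉ (fun w => dist w z) ''
      (compressedEigenvalues B d J ∩ Metric.closedBall 0 (‖z‖ + ε)) := by
    by_contra! hcon
    exact (Set.Ioo_infinite hε) ((hfin.image _).subset hcon)
  have hle : ∀ w, dist w z ≤ r → ‖w‖ ≤ ‖z‖ + ε := fun w hw => by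
    rw [dist_eq_norm] at hw
    have := norm_add_le (w - z) z
    rw [sub_add_cancel] at this
    linarith
  have hsph : ∀ w ∈ Metric.sphere z r, w ∉ compressedEigenvalues B d J := fun w hw hwJ =>
    hr ⟨w, ⟨hwJ, by simpa using hle w (le_of_eq hw)⟩, hw⟩
  obtain ⟨c, hc, hcS⟩ := exists_norm_le_mul_norm_sub_compressedPencil (B := B) (J := J) hd hd'
    (isCompact_sphere z r) hsph
  obtain ⟨F, hF⟩ := exists_finset_norm_compressedPencil_sub_le B hd hd' (‖z‖ + ε)
    (show 0 < (4 * c)⁻¹ by positivity)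
  refine ⟨F, fun J' hJ' => ?_⟩
  by_contra! hcon
  have hu : ∀ w ∈ Metric.closedBall z r, IsUnit (1 - compressedPencil B hd J' w) := fun w hw =>
    (isUnit_one_sub_compressedPencil_iff hd hd').2 fun hwJ => by
      have h1 := hcon w hwJ
      rw [dist_comm] at h1
      have h2 : dist w z ≤ r := hw
      linarith
  obtain ⟨V, hV⟩ := hz
  obtain ⟨hV0, hV1⟩ := (isCompressedEigenvector_iff hd).1 hV
  -- If `J'` had no eigenvalue within `ε`, then `w ↦ (1 - K_{J'}(w))⁻¹ U` would be holomorphic in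
  -- the disc. It equals `V` at the centre and has norm at most `2 * c * ‖U‖ ≤ ‖V‖ / 2` on the
  -- circle, against the maximum principle.
  set U := V - compressedPencil B hd J' z V with hU
  have hUV : ‖U‖ ≤ (4 * c)⁻¹ * ‖V‖ := by
    have := hF J' J hJ' z (hle z (by simpa using hr0.le)) V
    rwa [hV1, norm_sub_rev] at this
  have happ : ∀ w ∈ Metric.closedBall z r, ∀ X,
      Ring.inverse (1 - compressedPencil B hd J' w) X -
        compressedPencil B hd J' w (Ring.inverse (1 - compressedPencil B hd J' w) X) = X := by
    intro w hw X
    have := congrArg (fun T : EllTwo ι →L[ℂ] EllTwo ι => T X) (Ring.mul_inverse_cancel _ (hu w hw))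
    simpa using this
  have hbd : ∀ w ∈ Metric.sphere z r,
      ‖Ring.inverse (1 - compressedPencil B hd J' w) U‖ ≤ 2 * c * ‖U‖ := by
    intro w hw
    set X := Ring.inverse (1 - compressedPencil B hd J' w) U with hX
    have h1 := hcS w hw X
    have h2 := hF J' J hJ' w (hle w (le_of_eq hw)) X
    have h3 := happ w (Metric.sphere_subset_closedBall hw) U
    rw [← hX] at h3
    have h4 : X - compressedPencil B hd J w X =
        U + (compressedPencil B hd J' w X - compressedPencil B hd J w X) := by
      rw [← h3]; abel
    rw [h4] at h1
    have h5 := h1.trans (mul_le_mul_of_nonneg_left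
      ((norm_add_le _ _).trans (add_le_add_right h2 _)) hc.le)
    -- The perturbation term is absorbed on the left, leaving `3/4` of `‖X‖`.
    have h6 : c * (‖U‖ + (4 * c)⁻¹ * ‖X‖) = c * ‖U‖ + ‖X‖ / 4 := by field_simp
    rw [h6] at h5
    have := norm_nonneg X
    linarith
  have hdiff : DiffContOnCl ℂ (fun w => Ring.inverse (1 - compressedPencil B hd J' w) U)
      (Metric.ball z r) := by
    refine ⟨fun w hw => ?_, ?_⟩
    · have h1 : DifferentiableAt ℂ (fun w => Ring.inverse (1 - compressedPencil B hd J' w)) w :=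
        (differentiable_compressedPencil hd w).inverse
          (hu w (Metric.ball_subset_closedBall hw))
      exact (h1.clm_apply (differentiableAt_const U)).differentiableWithinAt
    · rw [closure_ball z hr0.ne']
      exact (continuousOn_inverse_compressedPencil hd hu).clm_apply continuousOn_const
  have hmax := Complex.norm_le_of_forall_mem_frontier_norm_le Metric.isBounded_ball hdiff
    (C := 2 * c * ‖U‖) (by rw [frontier_ball z hr0.ne']; exact hbd)
    (subset_closure (Metric.mem_ball_self hr0))
  have hVU : Ring.inverse (1 - compressedPencil B hd J' z) U = V := by
    have := congrArg (fun T : EllTwo ι →L[ℂ] EllTwo ι => T V)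
      (Ring.inverse_mul_cancel _ (hu z (Metric.mem_closedBall_self hr0.le)))
    simpa [hU] using this
  rw [hVU] at hmax
  have h7 := hmax.trans (mul_le_mul_of_nonneg_left hUV (by positivity : 0 ≤ 2 * c))
  have h8 : 2 * c * ((4 * c)⁻¹ * ‖V‖) = ‖V‖ / 2 := by field_simp; norm_num
  have := norm_pos_iff.2 hV0
  linarith

/-- The finite set of coordinates in the second direction depends on the eigenvalue; since only
finitely many lie in the ball, a union of these sets works for all. -/
theorem exists_finset_compressedEigenvalues_approx (hd : ∀ i, (d i).re = 0)
    (hd' : Tendsto (fun i => ‖d i‖) cofinite atTop) (J : Set ι) (R : ℝ) {ε : ℝ} (hε : 0 < ε) :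
    ∃ F : Finset ι, ∀ J' : Set ι, (∀ i ∈ F, i ∈ J' ↔ i ∈ J) →
      (∀ z ∈ compressedEigenvalues B d J', ‖z‖ ≤ R →
        ∃ w ∈ compressedEigenvalues B d J, dist z w < ε) ∧
      ∀ z ∈ compressedEigenvalues B d J, ‖z‖ ≤ R →
        ∃ w ∈ compressedEigenvalues B d J', dist z w < ε := by
  classical
  obtain ⟨F₁, hF₁⟩ := exists_finset_compressedEigenvalues_subset (B := B) hd hd' J R hε
  have hfin := finite_compressedEigenvalues_inter_closedBall (B := B) (J := J) hd hd' R
  have hex : ∀ z, ∃ F : Finset ι, z ∈ compressedEigenvalues B d J → ∀ J' : Set ι,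
      (∀ i ∈ F, i ∈ J' ↔ i ∈ J) → ∃ w ∈ compressedEigenvalues B d J', dist z w < ε := fun z => by
    by_cases hz : z ∈ compressedEigenvalues B d J
    · obtain ⟨F, hF⟩ := exists_finset_exists_mem_compressedEigenvalues hd hd' hz hε
      exact ⟨F, fun _ => hF⟩
    · exact ⟨∅, fun h => absurd h hz⟩
  choose F hF using hex
  refine ⟨F₁ ∪ hfin.toFinset.biUnion F, fun J' hJ' => ⟨fun z hz hzR => ?_, fun z hz hzR => ?_⟩⟩
  · exact hF₁ J' (fun i hi => hJ' i (Finset.mem_union_left _ hi)) z hz hzR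
  · refine hF z hz J' (fun i hi => hJ' i (Finset.mem_union_right _ ?_))
    exact Finset.mem_biUnion.2 ⟨z, hfin.mem_toFinset.2 ⟨hz, by simpa using hzR⟩, hi⟩

end SpectralApproximation

/-! ### From infinite matrices to compressions of `B + d`. -/

section Matrix

variable {ι κ : Type*} {M : Matrix ι ι ℂ} {B : EllTwo ι →L[ℂ] EllTwo ι} {d : ι → ℂ}

/-- The matrix `M` acts on `ℓ²(ι)` as the sum of the bounded operator `B` and the diagonal `d`. -/
def HasBoundedPlusDiagonal (M : Matrix ι ι ℂ) (B : EllTwo ι →L[ℂ] EllTwo ι) (d : ι → ℂ) : Prop :=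
  ∀ (V : EllTwo ι) (i : ι), HasSum (fun j => M i j * V j) (B V i + d i * V i)

/-- Extension of a vector by zero along an embedding of index sets. -/
noncomputable def extendVec (e : κ ↪ ι) (V : EllTwo κ) : EllTwo ι :=
  ⟨Function.extend e V 0, by
    refine (memℓp_gen_iff (p := 2) (by norm_num)).2 ?_
    have h := (memℓp_gen_iff (p := 2) (by norm_num)).1 (lp.memℓp V)
    refine (e.injective.summable_iff (fun i hi => ?_)).1 (by
      simpa only [Function.comp_def, e.injective.extend_apply] using h)
    rw [Function.extend_apply' _ _ _ (by simpa using hi)]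
    simp⟩

@[simp] theorem extendVec_apply (e : κ ↪ ι) (V : EllTwo κ) (p : κ) :
    extendVec e V (e p) = V p := e.injective.extend_apply _ _ _

theorem extendVec_apply_of_notMem (e : κ ↪ ι) (V : EllTwo κ) {i : ι} (hi : i ∉ Set.range e) :
    extendVec e V i = 0 := Function.extend_apply' _ _ _ (by simpa using hi)

@[simp] theorem truncVec_apply (e : κ ↪ ι) (V : EllTwo ι) (p : κ) : truncVec e V p = V (e p) := rfl

theorem extendVec_truncVec (e : κ ↪ ι) (V : EllTwo ι) :
    extendVec e (truncVec e V) = coordProj (Set.range e) V := by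
  classical
  ext i
  rw [coordProj_apply]
  split_ifs with hi
  · obtain ⟨p, rfl⟩ := hi; simp
  · exact extendVec_apply_of_notMem e _ hi

theorem norm_extendVec (e : κ ↪ ι) (V : EllTwo κ) : ‖extendVec e V‖ = ‖V‖ := by
  have h : ‖extendVec e V‖ ^ 2 = ‖V‖ ^ 2 := by
    rw [EllTwo.norm_sq_eq_tsum, EllTwo.norm_sq_eq_tsum, ← e.injective.tsum_eq]
    · simp
    · intro i hi
      by_contra hcon
      exact hi (by simp [extendVec_apply_of_notMem e V hcon])
  exact (sq_eq_sq₀ (norm_nonneg _) (norm_nonneg _)).1 h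

/-- Extension by zero turns a row sum of the submatrix into a row sum of `M`, so every truncation
lives on `EllTwo ι`. -/
theorem HasBoundedPlusDiagonal.mapsVec_submatrix_iff (hM : HasBoundedPlusDiagonal M B d)
    (e : κ ↪ ι) (V W : EllTwo κ) :
    MapsVec (M.submatrix e e) V W ↔
      ∀ p, B (extendVec e V) (e p) + d (e p) * V p = W p := by
  refine forall_congr' fun p => ?_
  have h : HasSum (fun q => M (e p) (e q) * V q)
      (B (extendVec e V) (e p) + d (e p) * V p) := by
    have := hM (extendVec e V) (e p)
    rw [extendVec_apply, ← e.injective.hasSum_iff] at this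
    · simpa only [Function.comp_def, extendVec_apply] using this
    · intro i hi
      rw [extendVec_apply_of_notMem e V hi, mul_zero]
  exact ⟨fun h' => h.unique h', fun h' => h' ▸ h⟩

theorem HasBoundedPlusDiagonal.mapsVec_iff (hM : HasBoundedPlusDiagonal M B d)
    (V W : EllTwo ι) : MapsVec M V W ↔ ∀ i, B V i + d i * V i = W i :=
  forall_congr' fun i => ⟨fun h => (hM V i).unique h, fun h => h ▸ hM V i⟩

theorem HasBoundedPlusDiagonal.isEigenvector_submatrix_iff (hM : HasBoundedPlusDiagonal M B d)
    (e : κ ↪ ι) (z : ℂ) (V : EllTwo κ) :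
    IsEigenvector (M.submatrix e e) z V ↔
      IsCompressedEigenvector B d (Set.range e) z (extendVec e V) := by
  rw [IsEigenvector, IsCompressedEigenvector, hM.mapsVec_submatrix_iff]
  refine and_congr (not_congr ?_) ⟨fun h => ⟨fun i hi => extendVec_apply_of_notMem e V hi, ?_⟩,
    fun h p => ?_⟩
  · rw [← norm_eq_zero, ← norm_extendVec e, norm_eq_zero]
  · rintro _ ⟨p, rfl⟩
    simpa using h p
  · simpa using h.2 (e p) ⟨p, rfl⟩

theorem HasBoundedPlusDiagonal.eigenvalueSet_submatrix (hM : HasBoundedPlusDiagonal M B d)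
    (e : κ ↪ ι) :
    eigenvalueSet (M.submatrix e e) = compressedEigenvalues B d (Set.range e) := by
  ext z
  refine ⟨fun ⟨V, hV⟩ => ⟨_, (hM.isEigenvector_submatrix_iff e z V).1 hV⟩, fun ⟨V, hV⟩ => ?_⟩
  refine ⟨truncVec e V, (hM.isEigenvector_submatrix_iff e z _).2 ?_⟩
  rwa [extendVec_truncVec, coordProj_eq_self hV.2.1]

theorem HasBoundedPlusDiagonal.eigenvalueSet_eq (hM : HasBoundedPlusDiagonal M B d) :
    eigenvalueSet M = compressedEigenvalues B d Set.univ := by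
  have h := hM.eigenvalueSet_submatrix (Function.Embedding.refl ι)
  rwa [show Set.range (Function.Embedding.refl ι) = Set.univ from Set.range_id] at h

/-- An operator with compact resolvent has pure point spectrum. -/
theorem HasBoundedPlusDiagonal.operatorSpectrum_eq (hM : HasBoundedPlusDiagonal M B d)
    (hd : ∀ i, (d i).re = 0) (hd' : Tendsto (fun i => ‖d i‖) cofinite atTop) :
    operatorSpectrum M = eigenvalueSet M := by
  ext z
  rw [hM.eigenvalueSet_eq]
  constructor
  · intro h
    by_contra hz
    refine h ?_
    have hu := (isUnit_one_sub_compressedPencil_iff hd hd').2 hz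
    -- Applying the diagonal resolvent turns `(M - z) V = W` into `(1 - K(z)) V = diagResolvent W`,
    -- which gives the inverse of `M - z`.
    refine ⟨Ring.inverse (1 - compressedPencil B hd Set.univ z) ∘L diagResolvent hd Set.univ,
      fun V W => ?_⟩
    have h1 : MapsVec M V (W + z • V) ↔
        V - compressedPencil B hd Set.univ z V = diagResolvent hd Set.univ W := by
      have hp : coordProj Set.univ V = V := coordProj_eq_self (fun i hi => absurd trivial hi)
      rw [hM.mapsVec_iff]
      refine Iff.trans ?_ (lp.ext_iff.trans funext_iff).symm
      refine forall_congr' fun i => ?_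
      have hne := sub_one_ne_zero_of_re_eq_zero (hd i)
      rw [compressedPencil_apply, hp, lp.coeFn_sub, Pi.sub_apply, diagResolvent_apply,
        diagResolvent_apply, if_pos (Set.mem_univ i), if_pos (Set.mem_univ i),
        sub_eq_iff_eq_add, ← mul_add, eq_inv_mul_iff_mul_eq₀ hne]
      simp only [lp.coeFn_add, lp.coeFn_sub, lp.coeFn_smul, Pi.add_apply, Pi.sub_apply,
        Pi.smul_apply, smul_eq_mul]
      constructor <;> intro h <;> linear_combination h
    rw [h1]
    have h2 : V - compressedPencil B hd Set.univ z V =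
      (1 - compressedPencil B hd Set.univ z) V := by simp
    rw [h2]
    constructor
    · intro h3
      have := congrArg (fun T : EllTwo ι →L[ℂ] EllTwo ι => T V) (Ring.inverse_mul_cancel _ hu)
      rw [ContinuousLinearMap.comp_apply, ← h3]
      exact this.symm
    · rintro rfl
      exact congrArg (fun T : EllTwo ι →L[ℂ] EllTwo ι => T (diagResolvent hd Set.univ W))
        (Ring.mul_inverse_cancel _ hu)
  · rintro ⟨V, hV0, -, hV⟩ ⟨R, hR⟩
    refine hV0 ?_
    rw [← map_zero R]
    refine (hR V 0).1 ?_
    rw [hM.mapsVec_iff, zero_add]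
    exact fun i => hV i trivial

end Matrix

/-! ### Residuals of truncated eigenvectors. -/

section TruncationResidual

variable {ι κ κ' : Type*} {M : Matrix ι ι ℂ} {B : EllTwo ι →L[ℂ] EllTwo ι} {d : ι → ℂ}

theorem norm_truncVec (e : κ ↪ ι) (V : EllTwo ι) :
    ‖truncVec e V‖ = ‖coordProj (Set.range e) V‖ := by
  rw [← norm_extendVec e, extendVec_truncVec]

theorem norm_truncVec_le (e : κ ↪ ι) (V : EllTwo ι) : ‖truncVec e V‖ ≤ ‖V‖ :=
  (norm_truncVec e V).trans_le (norm_coordProj_le _ _)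

/-- If the truncation discards only coordinates where the diagonal is far from the eigenvalue `z`,
then truncated eigenvectors are approximate eigenvectors. -/
theorem HasBoundedPlusDiagonal.isApproxEigenvalueByTrunc (hM : HasBoundedPlusDiagonal M B d)
    (e : κ ↪ ι) (f : κ' ↪ κ) {z : ℂ} {c ε : ℝ} (hc : 0 < c)
    (hε : ‖B‖ * (c⁻¹ * ‖B‖) < ε * (1 - c⁻¹ * ‖B‖)) (hε0 : 0 < ε)
    (hz : z ∈ eigenvalueSet (M.submatrix e e))
    (hfar : ∀ p : κ, p ∉ Set.range f → c ≤ ‖z - d (e p)‖) :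
    IsApproxEigenvalueByTrunc (M.submatrix e e) f ε z := by
  classical
  refine ⟨hz, fun V hV => ?_⟩
  have hV' := (hM.isEigenvector_submatrix_iff e z V).1 hV
  set X := extendVec e V with hX
  set g := f.trans e with hg
  have hgV : truncVec f V = truncVec g X := by
    ext p; simp [hX, hg]
  have hPX : coordProj (Set.range g) X - X = -coordProj (Set.range g)ᶜ X := by
    ext i
    rw [lp.coeFn_sub, Pi.sub_apply, lp.coeFn_neg, Pi.neg_apply, coordProj_apply, coordProj_apply]
    by_cases hi : i ∈ Set.range g
    · rw [if_pos hi, if_neg (fun h => h hi), sub_self, neg_zero]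
    · rw [if_neg hi, if_pos (Set.mem_compl hi), zero_sub]
  have htail : ‖coordProj (Set.range g)ᶜ X‖ ≤ c⁻¹ * ‖B‖ * ‖X‖ := by
    refine hV'.norm_coordProj_le hc ?_
    rintro _ hi ⟨p, rfl⟩
    refine hfar p fun ⟨q, hq⟩ => hi ⟨q, ?_⟩
    rw [hg, Function.Embedding.trans_apply, hq]
  -- On the retained coordinates the diagonal terms cancel, so the residual sees only `B` applied to
  -- the discarded part of `X`.
  refine ⟨truncVec g (B (coordProj (Set.range g) X - X)), ?_, ?_⟩
  · have h := (hM.mapsVec_submatrix_iff g (truncVec f V)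
      (truncVec g (B (coordProj (Set.range g) X - X)) + z • truncVec f V)).2 (fun p => by
        have h1 := hV'.2.2 (g p) ⟨f p, rfl⟩
        have h2 : extendVec g (truncVec f V) = coordProj (Set.range g) X := by
          rw [hgV, extendVec_truncVec]
        rw [h2, hgV, lp.coeFn_add, Pi.add_apply, lp.coeFn_smul, Pi.smul_apply, truncVec_apply,
          truncVec_apply, map_sub, lp.coeFn_sub, Pi.sub_apply, smul_eq_mul]
        linear_combination h1)
    exact h
  · have hXpos : 0 < ‖X‖ := norm_pos_iff.2 hV'.1
    have h1 : ‖truncVec g (B (coordProj (Set.range g) X - X))‖ ≤ ‖B‖ * (c⁻¹ * ‖B‖) * ‖X‖ := by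
      refine (norm_truncVec_le _ _).trans ((B.le_opNorm _).trans ?_)
      rw [hPX, norm_neg, mul_assoc ‖B‖]
      exact mul_le_mul_of_nonneg_left htail (norm_nonneg _)
    have h2 : (1 - c⁻¹ * ‖B‖) * ‖X‖ ≤ ‖truncVec f V‖ := by
      rw [hgV, norm_truncVec]
      have h3 : X = coordProj (Set.range g) X + coordProj (Set.range g)ᶜ X := by
        rw [← sub_eq_iff_eq_add', ← neg_sub, hPX, neg_neg]
      have h4 := norm_add_le (coordProj (Set.range g) X) (coordProj (Set.range g)ᶜ X)
      rw [← h3] at h4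
      linarith
    calc _ ≤ ‖B‖ * (c⁻¹ * ‖B‖) * ‖X‖ := h1
      _ < ε * (1 - c⁻¹ * ‖B‖) * ‖X‖ := mul_lt_mul_of_pos_right hε hXpos
      _ = ε * ((1 - c⁻¹ * ‖B‖) * ‖X‖) := by ring
      _ ≤ _ := mul_le_mul_of_nonneg_left h2 hε0.le

/-- Here `c` is the distance from the eigenvalue to the discarded diagonal entries. The left side
bounds the residual, and `1 - c⁻¹ * b` is the share of the norm that survives truncation. -/
theorem exists_pos_mul_inv_mul_lt (b : ℝ) {ε : ℝ} (hε : 0 < ε) :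
    ∃ c > 0, b * (c⁻¹ * b) < ε * (1 - c⁻¹ * b) := by
  have h1 : Tendsto (fun c : ℝ => b * (c⁻¹ * b)) atTop (𝓝 (b * (0 * b))) :=
    (tendsto_inv_atTop_zero.mul_const b).const_mul b
  have h2 : Tendsto (fun c : ℝ => ε * (1 - c⁻¹ * b)) atTop (𝓝 (ε * (1 - 0 * b))) :=
    ((tendsto_inv_atTop_zero.mul_const b).const_sub 1).const_mul ε
  obtain ⟨c, hc, hc0⟩ := ((h1.eventually_lt h2 (by simpa using hε)).and
    (eventually_gt_atTop 0)).exists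
  exact ⟨c, hc0, hc⟩

end TruncationResidual

/-! ### Boundedness of the block Laurent operator. -/

section LaurentOperator

theorem hasSum_apply_single {ι κ : Type*} [DecidableEq ι] (B : EllTwo ι →L[ℂ] EllTwo κ)
    (V : EllTwo ι) (k : κ) : HasSum (fun l => B (lp.single 2 l 1) k * V l) (B V k) := by
  have h := (lp.evalCLM ℂ (fun _ : κ => ℂ) 2 k ∘L B).hasSum
    (lp.hasSum_single (p := 2) (by norm_num) V)
  have h2 (l : ι) : (lp.evalCLM ℂ (fun _ : κ => ℂ) 2 k ∘L B) (lp.single 2 l (V l)) =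
      B (lp.single 2 l 1) k * V l := by
    rw [show lp.single (E := fun _ : ι => ℂ) 2 l (V l) = V l • lp.single 2 l (1 : ℂ) by
      rw [← lp.single_smul, smul_eq_mul, mul_one], map_smul, smul_eq_mul, mul_comm]
    rfl
  simp only [h2] at h
  exact h

/-- Truncation of vectors, as a bounded operator. -/
noncomputable def truncCLM {ι κ : Type*} (e : κ ↪ ι) : EllTwo ι →L[ℂ] EllTwo κ :=
  LinearMap.mkContinuous
    { toFun := truncVec e
      map_add' := fun _ _ => rfl
      map_smul' := fun _ _ => rfl } 1 (fun V => by rw [one_mul]; exact norm_truncVec_le e V)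

/-- Extension of vectors by zero, as a bounded operator. -/
noncomputable def extendCLM {ι κ : Type*} (e : κ ↪ ι) : EllTwo κ →L[ℂ] EllTwo ι :=
  LinearMap.mkContinuous
    { toFun := extendVec e
      map_add' := fun V W => by
        ext i
        by_cases hi : i ∈ Set.range e
        · obtain ⟨p, rfl⟩ := hi; simp
        · simp [extendVec_apply_of_notMem e _ hi]
      map_smul' := fun c V => by
        ext i
        by_cases hi : i ∈ Set.range e
        · obtain ⟨p, rfl⟩ := hi; simp
        · simp [extendVec_apply_of_notMem e _ hi] } 1
    (fun V => by rw [one_mul]; exact (norm_extendVec e V).le)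

/-- A finite matrix of bounded operators defines a bounded operator. -/
theorem exists_blockOperator {α β : Type*} [Fintype α]
    (b : α → α → EllTwo β →L[ℂ] EllTwo β) :
    ∃ B : EllTwo (α × β) →L[ℂ] EllTwo (α × β), ∀ V i k,
      B V (i, k) = ∑ j, b i j (truncVec (Function.Embedding.sectR j β) V) k := by
  classical
  refine ⟨∑ i, ∑ j, extendCLM (Function.Embedding.sectR i β) ∘L b i j ∘L
    truncCLM (Function.Embedding.sectR j β), fun V i k => ?_⟩
  simp only [sum_apply, lp.coeFn_sum, Finset.sum_apply]
  rw [Finset.sum_eq_single i]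
  · refine Finset.sum_congr rfl fun j _ => ?_
    exact extendVec_apply (Function.Embedding.sectR i β) _ k
  · intro i' _ hi'
    refine Finset.sum_eq_zero fun j _ => ?_
    refine extendVec_apply_of_notMem (Function.Embedding.sectR i' β) _ ?_
    rintro ⟨k', hk'⟩
    exact hi' (congrArg Prod.fst hk')
  · simp

open AddCircle in
/-- The Laurent matrix of a bounded symbol defines a bounded operator on `ℓ²(ℤ)`. -/
theorem exists_laurentOperator {T : ℝ} (hT : 0 < T) {f : ℝ → ℝ}
    (hf : MemLp f ⊤ (volume.restrict (Set.Icc 0 T))) :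
    ∃ B : EllTwo ℤ →L[ℂ] EllTwo ℤ, ∀ k l : ℤ,
      B (lp.single 2 l 1) k = phasor T f (k - l) := by
  have : Fact (0 < T) := ⟨hT⟩
  have hf' : MemLp (fun t => (f t : ℂ)) ⊤ (volume.restrict (Set.Ioc 0 (0 + T))) := by
    rw [zero_add]
    exact (hf.mono_measure (Measure.restrict_mono Set.Ioc_subset_Icc_self le_rfl)).ofReal
  have hg := hf'.memLp_liftIoc.haarAddCircle
  set g := hg.toLp with hgdef
  -- Multiplication by the bounded symbol on `L²` of the circle; the Fourier basis carries it to the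
  -- Laurent matrix.
  let S : Lp ℂ 2 (haarAddCircle (T := T)) →L[ℂ] Lp ℂ 2 (haarAddCircle (T := T)) :=
    (ContinuousLinearMap.mul ℂ ℂ).holderL haarAddCircle ⊤ 2 2 g
  have hS (h : Lp ℂ 2 (haarAddCircle (T := T))) :
      S h =ᵐ[haarAddCircle] fun x => liftIoc T 0 (fun t => (f t : ℂ)) x * h x := by
    have h1 := (ContinuousLinearMap.mul ℂ ℂ).coeFn_holder (r := 2) g h
    filter_upwards [h1, hg.coeFn_toLp] with x hx hx'
    rw [← hx']
    exact hx
  refine ⟨(fourierBasis (T := T)).repr.toContinuousLinearEquiv.toContinuousLinearMap ∘L S ∘L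
    (fourierBasis (T := T)).repr.symm.toContinuousLinearEquiv.toContinuousLinearMap,
    fun k l => ?_⟩
  have h1 : (fourierBasis (T := T)).repr (S ((fourierBasis (T := T)).repr.symm (lp.single 2 l 1))) k
      = phasor T f (k - l) := by
    rw [fourierBasis_repr, HilbertBasis.repr_symm_single, coe_fourierBasis]
    have h2 : fourierCoeff (S (fourierLp 2 l)) k =
        fourierCoeff (liftIoc T 0 (fun t => (f t : ℂ))) (k - l) := by
      rw [fourierCoeff, fourierCoeff]
      refine integral_congr_ae ?_
      filter_upwards [hS (fourierLp 2 l), coeFn_fourierLp 2 l] with x hx hx'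
      rw [hx, hx', show -(k - l) = -k + l by ring, fourier_add, smul_eq_mul, smul_eq_mul]
      ring
    rw [h2, fourierCoeff_liftIoc_eq, fourierCoeffOn_eq_integral, phasor]
    simp only [zero_add, sub_zero, smul_eq_mul, fourier_coe_apply]
    rw [Complex.real_smul]
    congr 1
    · push_cast; rfl
    · refine intervalIntegral.integral_congr fun t _ => ?_
      rw [mul_comm]
      congr 2
      push_cast
      ring
  exact h1

end LaurentOperator

/-! ### Transport of eigenvalues along symmetries of the matrix. -/

section Reindexing

variable {κ κ' : Type*}

theorem add_mem_eigenvalueSet_of_reindex [DecidableEq κ] {M : Matrix κ κ ℂ} {M' : Matrix κ' κ' ℂ}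
    (σ : κ ≃ κ') (c : ℂ) (h : ∀ p q, M' (σ p) (σ q) = M p q + if p = q then c else 0) {z : ℂ}
    (hz : z ∈ eigenvalueSet M) : z + c ∈ eigenvalueSet M' := by
  obtain ⟨V, hV0, hV⟩ := hz
  refine ⟨truncVec σ.symm.toEmbedding V, fun h0 => hV0 ?_, fun p' => ?_⟩
  · ext p
    have := congrArg (fun W : EllTwo κ' => W (σ p)) h0
    simpa using this
  · obtain ⟨p, rfl⟩ := σ.surjective p'
    rw [← σ.hasSum_iff]
    have h1 : HasSum (fun q => (if p = q then c else 0) * V q) (c * V p) := by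
      have := hasSum_ite_eq p (c * V p)
      convert! this using 2 with q
      by_cases hq : q = p
      · subst hq; simp
      · simp [hq, Ne.symm hq]
    have h2 := (hV p).add h1
    have h3 : (fun q => M p q * V q + (if p = q then c else 0) * V q) =
        (fun q' => M' (σ p) q' * truncVec σ.symm.toEmbedding V q') ∘ σ := by
      funext q
      simp [h, add_mul]
    rw [h3] at h2
    convert! h2 using 1
    simp [add_mul]

theorem star_mem_eigenvalueSet_of_reindex {M : Matrix κ κ ℂ} {M' : Matrix κ' κ' ℂ}
    (σ : κ ≃ κ') (h : ∀ p q, M' (σ p) (σ q) = star (M p q)) {z : ℂ}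
    (hz : z ∈ eigenvalueSet M) : star z ∈ eigenvalueSet M' := by
  obtain ⟨V, hV0, hV⟩ := hz
  refine ⟨star (truncVec σ.symm.toEmbedding V), fun h0 => hV0 ?_, fun p' => ?_⟩
  · ext p
    have := congrArg (fun W : EllTwo κ' => W (σ p)) h0
    simpa using this
  · obtain ⟨p, rfl⟩ := σ.surjective p'
    rw [← σ.hasSum_iff]
    have h2 := (hV p).star
    have h3 : (fun q => star (M p q * V q)) =
        (fun q' => M' (σ p) q' * (star (truncVec σ.symm.toEmbedding V) : EllTwo κ') q') ∘ σ := by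
      funext q
      simp [h]
    rw [h3] at h2
    convert! h2 using 1
    simp

end Reindexing

/-! ### The harmonic operator: shift and conjugation symmetries, estimates uniform in the window. -/

section Harmonic

variable {n : ℕ} {T : ℝ} {A : ℝ → Matrix (Fin n) (Fin n) ℝ}

/-- The diagonal `-jωk` of `-𝒩`. -/
noncomputable def harmonicDiag (n : ℕ) (T : ℝ) : Fin n × ℤ → ℂ :=
  fun p => -(Complex.I * (2 * Real.pi / T : ℝ) * p.2)

theorem harmonicDiag_re (p : Fin n × ℤ) : (harmonicDiag n T p).re = 0 := by
  simp [harmonicDiag]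

theorem norm_I_mul_mul_intCast {ω : ℝ} (hω : 0 < ω) (k : ℤ) :
    ‖Complex.I * (ω : ℂ) * k‖ = ω * |(k : ℝ)| := by
  rw [norm_mul, norm_mul, Complex.norm_I, one_mul, Complex.norm_real, Real.norm_of_nonneg hω.le,
    Complex.norm_intCast]

theorem tendsto_norm_harmonicDiag (hT : 0 < T) :
    Tendsto (fun p => ‖harmonicDiag n T p‖) cofinite atTop := by
  have hω : 0 < 2 * Real.pi / T := by positivity
  refine tendsto_atTop.2 fun b => ?_
  have hfin : (Set.univ ×ˢ Set.Icc (-⌈b / (2 * Real.pi / T)⌉) ⌈b / (2 * Real.pi / T)⌉ :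
      Set (Fin n × ℤ)).Finite := Set.finite_univ.prod (Set.finite_Icc _ _)
  refine hfin.subset fun p hp => ⟨Set.mem_univ _, ?_⟩
  have h1 : ¬ b ≤ ‖harmonicDiag n T p‖ := hp
  rw [harmonicDiag, norm_neg, norm_I_mul_mul_intCast hω, not_le, mul_comm, ← lt_div_iff₀ hω] at h1
  have h2 : |(p.2 : ℝ)| ≤ (⌈b / (2 * Real.pi / T)⌉ : ℝ) := h1.le.trans (Int.le_ceil _)
  have h3 : |p.2| ≤ ⌈b / (2 * Real.pi / T)⌉ := by exact_mod_cast h2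
  exact abs_le.1 h3

theorem exists_hasBoundedPlusDiagonal_harmonicMatrix (hT : 0 < T)
    (hA : ∀ i j, MemLp (fun t => A t i j) ⊤ (volume.restrict (Set.Icc 0 T))) :
    ∃ B, HasBoundedPlusDiagonal (harmonicMatrix T A) B (harmonicDiag n T) := by
  classical
  choose b hb using fun i j => exists_laurentOperator hT (hA i j)
  obtain ⟨B, hB⟩ := exists_blockOperator b
  have hentry (i j : Fin n) (k l : ℤ) :
      B (lp.single 2 (j, l) 1) (i, k) = phasor T (fun t => A t i j) (k - l) := by
    rw [hB, Finset.sum_eq_single j]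
    · rw [← hb]
      have : truncVec (Function.Embedding.sectR j ℤ)
          (lp.single (E := fun _ : Fin n × ℤ => ℂ) 2 (j, l) 1) = lp.single 2 l 1 := by
        ext l'
        simp [lp.single_apply, Pi.single_apply]
      rw [this]
    · intro j' _ hj'
      have : truncVec (Function.Embedding.sectR j' ℤ)
          (lp.single (E := fun _ : Fin n × ℤ => ℂ) 2 (j, l) 1) = 0 := by
        ext l'
        simp [lp.single_apply, hj']
      rw [this, map_zero]; rfl
    · simp
  refine ⟨B, fun V p => ?_⟩
  have h1 := hasSum_apply_single B V p
  have h2 : HasSum (fun q => (if p = q then harmonicDiag n T p else 0) * V q)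
      (harmonicDiag n T p * V p) := by
    have := hasSum_ite_eq p (harmonicDiag n T p * V p)
    convert! this using 2 with q
    by_cases hq : q = p
    · subst hq; simp
    · simp [hq, Ne.symm hq]
  convert! h1.add h2 using 2 with q
  rw [hentry, ← add_mul, harmonicMatrix, harmonicDiag]
  split_ifs with h
  · ring
  · ring

/-- Uses that the signal is real; it is the source of the conjugation symmetry between the two
edges. -/
theorem star_phasor (f : ℝ → ℝ) (k : ℤ) : star (phasor T f k) = phasor T f (-k) := by
  rw [phasor, phasor, star_mul', RCLike.star_def,
    ← intervalIntegral.intervalIntegral_conj]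
  congr 1
  · simp
  · refine intervalIntegral.integral_congr fun t _ => ?_
    simp only [map_mul, map_neg, Complex.conj_ofReal, Complex.conj_I, map_intCast,
      ← Complex.exp_conj]
    congr 2
    push_cast
    ring

/-- The Toeplitz part depends only on `a - b`, so a shift is felt by the diagonal alone. -/
theorem harmonicMatrix_add (i j : Fin n) (a b k : ℤ) :
    harmonicMatrix T A (i, a + k) (j, b + k) = harmonicMatrix T A (i, a) (j, b) +
      if (i, a) = (j, b) then -(Complex.I * (2 * Real.pi / T : ℝ) * k) else 0 := by
  simp only [harmonicMatrix, add_sub_add_right_eq_sub, Prod.mk.injEq, add_left_inj]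
  split_ifs
  · push_cast; ring
  · ring

theorem harmonicMatrix_neg (i j : Fin n) (a b : ℤ) :
    harmonicMatrix T A (i, -a) (j, -b) = star (harmonicMatrix T A (i, a) (j, b)) := by
  simp only [harmonicMatrix, star_sub, star_phasor, Prod.mk.injEq, neg_inj, neg_sub_neg, neg_sub]
  congr 1
  split_ifs
  · simp
  · simp

theorem range_harmonicIndex (n : ℕ) (I : Set ℤ) :
    Set.range (harmonicIndex n I) = Prod.snd ⁻¹' I := by
  ext ⟨i, k⟩
  constructor
  · rintro ⟨⟨j, l⟩, h⟩
    rw [← h]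
    exact l.2
  · exact fun hk => ⟨(i, ⟨k, hk⟩), rfl⟩

theorem range_harmonicInclusion (n : ℕ) {I J : Set ℤ} (h : I ⊆ J) :
    Set.range (harmonicInclusion n h) = {p | (p.2 : ℤ) ∈ I} := by
  ext ⟨i, k⟩
  constructor
  · rintro ⟨⟨j, l⟩, h⟩
    rw [← h]
    exact l.2
  · exact fun hk => ⟨(i, ⟨k, hk⟩), rfl⟩

/-- The eigenvalues of the truncation of `𝒜 - 𝒩` to the harmonic orders in `I`. -/
abbrev truncEigenvalues (T : ℝ) (A : ℝ → Matrix (Fin n) (Fin n) ℝ) (I : Set ℤ) : Set ℂ :=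
  eigenvalueSet (truncMatrix (harmonicMatrix T A) I)

/-- Translating the harmonic orders translates the eigenvalues. -/
theorem sub_mem_truncEigenvalues (k : ℤ) {I I' : Set ℤ} (h : ∀ l, l ∈ I ↔ l + k ∈ I') {z : ℂ}
    (hz : z ∈ truncEigenvalues T A I) :
    z - Complex.I * (2 * Real.pi / T : ℝ) * k ∈ truncEigenvalues T A I' := by
  classical
  rw [sub_eq_add_neg]
  refine add_mem_eigenvalueSet_of_reindex (σ := (Equiv.refl (Fin n)).prodCongr
    ((Equiv.addRight k).subtypeEquiv h)) _ (fun p q => ?_) hz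
  obtain ⟨i, a, ha⟩ := p
  obtain ⟨j, b, hb⟩ := q
  refine (harmonicMatrix_add i j a b k).trans ?_
  simp only [Prod.mk.injEq, Subtype.mk.injEq]
  rfl

/-- As `A` is real, reflecting the harmonic orders conjugates the eigenvalues. -/
theorem star_mem_truncEigenvalues {I I' : Set ℤ} (h : ∀ l, l ∈ I ↔ -l ∈ I') {z : ℂ}
    (hz : z ∈ truncEigenvalues T A I) : star z ∈ truncEigenvalues T A I' := by
  refine star_mem_eigenvalueSet_of_reindex (σ := (Equiv.refl (Fin n)).prodCongr
    ((Equiv.neg ℤ).subtypeEquiv h)) (fun p q => ?_) hz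
  obtain ⟨i, a, ha⟩ := p
  obtain ⟨j, b, hb⟩ := q
  exact harmonicMatrix_neg i j a b

theorem HasBoundedPlusDiagonal.truncEigenvalues_eq {B : EllTwo (Fin n × ℤ) →L[ℂ] EllTwo (Fin n × ℤ)}
    (hM : HasBoundedPlusDiagonal (harmonicMatrix T A) B (harmonicDiag n T)) (I : Set ℤ) :
    truncEigenvalues T A I = compressedEigenvalues B (harmonicDiag n T) (Prod.snd ⁻¹' I) := by
  rw [← range_harmonicIndex]
  exact hM.eigenvalueSet_submatrix _

theorem truncEigenvalues_univ (hT : 0 < T)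
    (hA : ∀ i j, MemLp (fun t => A t i j) ⊤ (volume.restrict (Set.Icc 0 T))) :
    truncEigenvalues T A Set.univ = operatorSpectrum (harmonicMatrix T A) := by
  obtain ⟨B, hB⟩ := exists_hasBoundedPlusDiagonal_harmonicMatrix hT hA
  rw [hB.operatorSpectrum_eq harmonicDiag_re (tendsto_norm_harmonicDiag hT), hB.eigenvalueSet_eq,
    hB.truncEigenvalues_eq, Set.preimage_univ]

theorem eigenvalueSet_harmonicMatrix (hT : 0 < T)
    (hA : ∀ i j, MemLp (fun t => A t i j) ⊤ (volume.restrict (Set.Icc 0 T))) :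
    eigenvalueSet (harmonicMatrix T A) = operatorSpectrum (harmonicMatrix T A) := by
  obtain ⟨B, hB⟩ := exists_hasBoundedPlusDiagonal_harmonicMatrix hT hA
  exact (hB.operatorSpectrum_eq harmonicDiag_re (tendsto_norm_harmonicDiag hT)).symm

theorem finite_truncEigenvalues_inter_closedBall (hT : 0 < T)
    (hA : ∀ i j, MemLp (fun t => A t i j) ⊤ (volume.restrict (Set.Icc 0 T))) (I : Set ℤ) (R : ℝ) :
    (truncEigenvalues T A I ∩ Metric.closedBall 0 R).Finite := by
  obtain ⟨B, hB⟩ := exists_hasBoundedPlusDiagonal_harmonicMatrix hT hA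
  rw [hB.truncEigenvalues_eq]
  exact finite_compressedEigenvalues_inter_closedBall harmonicDiag_re
    (tendsto_norm_harmonicDiag hT) R

theorem sub_harmonicDiag (z : ℂ) (p : Fin n × ℤ) :
    z - harmonicDiag n T p = z + Complex.I * (2 * Real.pi / T : ℝ) * p.2 := by
  rw [harmonicDiag, sub_neg_eq_add]

/-- Each eigenvalue of a truncation lies at bounded distance from a diagonal entry. -/
theorem exists_bound_truncEigenvalues (hT : 0 < T)
    (hA : ∀ i j, MemLp (fun t => A t i j) ⊤ (volume.restrict (Set.Icc 0 T))) :
    ∃ C : ℝ, 0 < C ∧ ∀ (I : Set ℤ), ∀ z ∈ truncEigenvalues T A I,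
      ∃ k ∈ I, ‖z + Complex.I * (2 * Real.pi / T : ℝ) * k‖ ≤ C := by
  obtain ⟨B, hB⟩ := exists_hasBoundedPlusDiagonal_harmonicMatrix hT hA
  refine ⟨‖B‖ + 1, by positivity, fun I z hz => ?_⟩
  rw [hB.truncEigenvalues_eq] at hz
  obtain ⟨V, hV⟩ := hz
  obtain ⟨p, hp, hlt⟩ := hV.exists_norm_sub_lt (lt_add_one ‖B‖)
  rw [sub_harmonicDiag] at hlt
  exact ⟨p.2, hp, hlt.le⟩

/-- Truncations to sets of harmonic orders that agree on a long window around `k` have close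
eigenvalues in the corresponding bounded region. -/
theorem exists_window_truncEigenvalues_approx (hT : 0 < T)
    (hA : ∀ i j, MemLp (fun t => A t i j) ⊤ (volume.restrict (Set.Icc 0 T)))
    (J₀ : Set ℤ) (R : ℝ) {ε : ℝ} (hε : 0 < ε) :
    ∃ N : ℕ, ∀ (k : ℤ) (J J' : Set ℤ), (∀ l, l ∈ J₀ ↔ l + k ∈ J) →
      (∀ l : ℤ, |l| ≤ N → (l + k ∈ J' ↔ l + k ∈ J)) →
      (∀ z ∈ truncEigenvalues T A J', ‖z + Complex.I * (2 * Real.pi / T : ℝ) * k‖ ≤ R →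
        ∃ y ∈ truncEigenvalues T A J, dist z y < ε) ∧
      ∀ z ∈ truncEigenvalues T A J, ‖z + Complex.I * (2 * Real.pi / T : ℝ) * k‖ ≤ R →
        ∃ y ∈ truncEigenvalues T A J', dist z y < ε := by
  obtain ⟨B, hB⟩ := exists_hasBoundedPlusDiagonal_harmonicMatrix hT hA
  obtain ⟨F, hF⟩ := exists_finset_compressedEigenvalues_approx (B := B) harmonicDiag_re
    (tendsto_norm_harmonicDiag hT) (Prod.snd ⁻¹' J₀) R hε
  -- The largest harmonic order occurring in `F`; shifting by `k` moves the comparison from the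
  -- window around `k` to the one around `0`, so one `F` serves every `k`.
  refine ⟨F.sup fun p => p.2.natAbs, fun k J J' hJ hJ' => ?_⟩
  set w := Complex.I * (2 * Real.pi / T : ℝ) * k with hw
  set J₁ : Set ℤ := {l | l + k ∈ J'} with hJ₁
  have hJ₁' : ∀ l, l ∈ J₁ ↔ l + k ∈ J' := fun l => Iff.rfl
  have hagree : ∀ p ∈ F, p ∈ (Prod.snd ⁻¹' J₁ : Set (Fin n × ℤ)) ↔ p ∈ Prod.snd ⁻¹' J₀ := by
    intro p hp
    have h1 : p.2.natAbs ≤ F.sup fun p => p.2.natAbs := Finset.le_sup (f := fun p => p.2.natAbs) hp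
    have h2 := hJ' p.2 (by rw [Int.abs_eq_natAbs]; exact_mod_cast h1)
    exact h2.trans (hJ p.2).symm
  obtain ⟨h1, h2⟩ := hF _ hagree
  rw [← hB.truncEigenvalues_eq, ← hB.truncEigenvalues_eq] at h1 h2
  have down {I I' : Set ℤ} (h : ∀ l, l ∈ I ↔ l + k ∈ I') {z : ℂ}
      (hz : z ∈ truncEigenvalues T A I) : z - w ∈ truncEigenvalues T A I' :=
    sub_mem_truncEigenvalues k h hz
  have up {I I' : Set ℤ} (h : ∀ l, l ∈ I ↔ l + k ∈ I') {z : ℂ}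
      (hz : z ∈ truncEigenvalues T A I') : z + w ∈ truncEigenvalues T A I := by
    have := sub_mem_truncEigenvalues (T := T) (A := A) (-k) (I := I') (I' := I)
      (fun l => by rw [h, neg_add_cancel_right]) hz
    convert! this using 1
    rw [hw]; push_cast; ring
  have hdist (z y : ℂ) : dist z (y - w) = dist (z + w) y := by
    rw [dist_eq_norm, dist_eq_norm]; congr 1; ring
  refine ⟨fun z hz hzR => ?_, fun z hz hzR => ?_⟩
  · obtain ⟨y, hy, hlt⟩ := h1 _ (up hJ₁' hz) hzR
    exact ⟨y - w, down hJ hy, by rwa [hdist]⟩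
  · obtain ⟨y, hy, hlt⟩ := h2 _ (up hJ hz) hzR
    exact ⟨y - w, down hJ₁' hy, by rwa [hdist]⟩

/-- Truncating outside a long window around `k` turns eigenvectors, for eigenvalues in the
corresponding bounded region, into approximate eigenvectors. -/
theorem exists_window_isApproxEigenvalueByTrunc (hT : 0 < T)
    (hA : ∀ i j, MemLp (fun t => A t i j) ⊤ (volume.restrict (Set.Icc 0 T)))
    (R : ℝ) {ε : ℝ} (hε : 0 < ε) :
    ∃ N : ℕ, ∀ {κ κ' : Type} (e : κ ↪ Fin n × ℤ) (f : κ' ↪ κ) (k : ℤ) (z : ℂ),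
      z ∈ eigenvalueSet ((harmonicMatrix T A).submatrix e e) →
      ‖z + Complex.I * (2 * Real.pi / T : ℝ) * k‖ ≤ R →
      (∀ p, |(e p).2 - k| ≤ N → p ∈ Set.range f) →
      IsApproxEigenvalueByTrunc ((harmonicMatrix T A).submatrix e e) f ε z := by
  have hω : 0 < 2 * Real.pi / T := by positivity
  obtain ⟨B, hB⟩ := exists_hasBoundedPlusDiagonal_harmonicMatrix hT hA
  obtain ⟨c, hc, hcB⟩ := exists_pos_mul_inv_mul_lt ‖B‖ hε
  -- More than `N` orders away from `k`, the diagonal entry is at distance at least `ω N - R ≥ c`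
  -- from `z`.
  obtain ⟨N, hN⟩ := exists_nat_ge ((c + R) / (2 * Real.pi / T))
  refine ⟨N, fun e f k z hz hzR hf => hB.isApproxEigenvalueByTrunc e f hc hcB hε hz fun p hp => ?_⟩
  have h1 : (N : ℤ) < |(e p).2 - k| := not_le.1 fun h => hp (hf p h)
  have h2 : (N : ℝ) ≤ |(((e p).2 - k : ℤ) : ℝ)| := by exact_mod_cast h1.le
  have h3 := norm_I_mul_mul_intCast hω ((e p).2 - k)
  have h4 := (div_le_iff₀' hω).1 (hN.trans h2)
  have h5 := norm_sub_norm_le (Complex.I * (2 * Real.pi / T : ℝ) * ((e p).2 - k : ℤ))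
    (-(z + Complex.I * (2 * Real.pi / T : ℝ) * k))
  rw [norm_neg, h3] at h5
  rw [sub_harmonicDiag]
  have h6 : Complex.I * (2 * Real.pi / T : ℝ) * ((e p).2 - k : ℤ) -
      -(z + Complex.I * (2 * Real.pi / T : ℝ) * k) =
      z + Complex.I * (2 * Real.pi / T : ℝ) * (e p).2 := by push_cast; ring
  rw [h6] at h5
  linarith

end Harmonic

/-! ### Assembly: bulk eigenvalues and edge eigenvalues. -/

theorem mainTheorem4 {n : ℕ} {T : ℝ} (hT : 0 < T) (A : ℝ → Matrix (Fin n) (Fin n) ℝ)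
    (hper : Function.Periodic A T)
    (hA : ∀ i j, MemLp (fun t => A t i j) ⊤ (volume.restrict (Set.Icc 0 T)))
    (hnd : IsNonDefective (harmonicMatrix T A))
    (lam : Fin n → ℂ)
    (hspec : operatorSpectrum (harmonicMatrix T A) = floquetSet T lam Set.univ)
    (ε : ℝ) (hε : 0 < ε) :
    ∃ (j₀ : ℕ) (Λ₂ : ℕ → Set ℂ),
      -- the family `Λ₂⁺(m)` attached to the left truncations
      (∀ m : ℕ,
        (∀ z ∈ floquetSet T lam {k | k ≤ (m : ℤ) + 1 - j₀},
          IsApproxEigenvalueByTrunc (harmonicMatrix T A) (harmonicIndex n (Set.Ici (-(m : ℤ)))) ε z) ∧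
        (Λ₂ m).Finite ∧
        Λ₂ m ⊆ eigenvalueSet (truncMatrix (harmonicMatrix T A) (Set.Ici (-(m : ℤ)))) ∧
        Λ₂ (m + 1) = (fun z => z + Complex.I * (2 * Real.pi / T : ℝ)) '' Λ₂ m ∧
        SetApprox ε (eigenvalueSet (truncMatrix (harmonicMatrix T A) (Set.Ici (-(m : ℤ)))))
          (floquetSet T lam {k | k ≤ (m : ℤ) + 1 - j₀} ∪ Λ₂ m)) ∧
      ∃ m₀ : ℕ, ∀ m : ℕ, m₀ ≤ m →
        IsNonDefective (truncMatrix (harmonicMatrix T A) (Set.Icc (-(m : ℤ)) m)) →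
        (∀ z ∈ floquetSet T lam {k | |k| ≤ (m : ℤ) + 1 - j₀},
          IsApproxEigenvalueByTrunc (harmonicMatrix T A)
            (harmonicIndex n (Set.Icc (-(m : ℤ)) m)) ε z) ∧
        (∀ z ∈ Λ₂ m,
          IsApproxEigenvalueByTrunc (truncMatrix (harmonicMatrix T A) (Set.Ici (-(m : ℤ))))
            (harmonicInclusion n
              (Set.Icc_subset_Ici_self : Set.Icc (-(m : ℤ)) m ⊆ Set.Ici (-(m : ℤ)))) ε z) ∧
        (∀ z ∈ star '' Λ₂ m,
          IsApproxEigenvalueByTrunc (truncMatrix (harmonicMatrix T A) (Set.Iic (m : ℤ)))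
            (harmonicInclusion n
              (Set.Icc_subset_Iic_self : Set.Icc (-(m : ℤ)) m ⊆ Set.Iic (m : ℤ))) ε z) ∧
        SetApprox ε (eigenvalueSet (truncMatrix (harmonicMatrix T A) (Set.Icc (-(m : ℤ)) m)))
          (floquetSet T lam {k | |k| ≤ (m : ℤ) + 1 - j₀} ∪ star '' Λ₂ m ∪ Λ₂ m) := by
  have hω : 0 < 2 * Real.pi / T := by positivity
  have heig := (eigenvalueSet_harmonicMatrix hT hA).trans hspec
  have huniv := (truncEigenvalues_univ hT hA).trans hspec
  have hshift (k : ℤ) {I I' : Set ℤ} (h : ∀ l, l ∈ I ↔ l + k ∈ I') (z : ℂ)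
    (hz : z ∈ truncEigenvalues T A I) := sub_mem_truncEigenvalues k h hz
  have hnorm := norm_I_mul_mul_intCast hω
  have hwstar : star (Complex.I * ((2 * Real.pi / T : ℝ) : ℂ)) =
      -(Complex.I * (2 * Real.pi / T : ℝ)) := by
    rw [star_mul', RCLike.star_def, Complex.conj_I, Complex.conj_ofReal, neg_mul]
  obtain ⟨C, hC0, hC⟩ := exists_bound_truncEigenvalues hT hA
  obtain ⟨L, hL⟩ : ∃ L : ℝ, ∀ p, ‖lam p‖ ≤ L :=
    ⟨∑ p, ‖lam p‖, fun p => Finset.single_le_sum (f := fun p => ‖lam p‖)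
      (fun _ _ => norm_nonneg _) (Finset.mem_univ p)⟩
  -- The radius `C` serves `mid`, the radius `L` serves `low`.
  obtain ⟨N₁, hN₁⟩ := exists_window_truncEigenvalues_approx hT hA Set.univ (max C L) (half_pos hε)
  obtain ⟨N₂, hN₂⟩ := exists_window_isApproxEigenvalueByTrunc hT hA L hε
  -- `D` bounds the offset `k' + k` between the order `k` that localises an eigenvalue and the index
  -- `k'` of the Floquet point near it.
  obtain ⟨D, hD⟩ := exists_nat_ge ((C + ε + L) / (2 * Real.pi / T))
  rw [div_le_iff₀' hω] at hD
  have hfin := finite_truncEigenvalues_inter_closedBall hT hA (Set.Ici 0)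
    (C + 2 * Real.pi / T * (N₁ + N₂ + 1 + D + N₁ : ℕ) + ε)
  obtain ⟨N₃, hN₃⟩ := exists_window_truncEigenvalues_approx hT hA (Set.Ici 0)
    (C + 2 * Real.pi / T * (N₁ + N₂ + 1 + D + N₁ : ℕ) + ε) (half_pos hε)
  obtain ⟨N₄, hN₄⟩ := exists_window_isApproxEigenvalueByTrunc hT hA
    (C + 2 * Real.pi / T * (N₁ + N₂ + 1 + D + N₁ : ℕ) + ε) hε
  set w : ℂ := Complex.I * (2 * Real.pi / T : ℝ) with hw
  set ω : ℝ := 2 * Real.pi / T with hωdef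
  -- For `k ≤ m + 1 - j₀` the windows of half-widths `N₁` and `N₂` about `-k` stay in the orders `≥
  -- -m`.
  set j₀ : ℕ := N₁ + N₂ + 1 with hj₀
  -- Width of the edge zone. For `k > -m + G` the window of half-width `N₁` about `k` misses the
  -- edge, and an index `k'` with `|k' + k| ≤ D` satisfies `k' ≤ m + 1 - j₀`.
  set G : ℕ := j₀ + D + N₁ with hG
  -- `C + ω * G` bounds the shifted edge eigenvalues (`hedge`); the extra `ε` keeps their
  -- approximants inside the ball that defines `Λ₂`.
  set R : ℝ := C + ω * (G : ℕ) + ε with hR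
  set E : Set ℤ → Set ℂ := fun I => truncEigenvalues T A I with hE
  -- Bulk eigenvalues: around `k` the truncation cannot be told from the full operator.
  have mid : ∀ (J : Set ℤ) (k : ℤ), (∀ l, |l - k| ≤ N₁ → l ∈ J) → ∀ z ∈ E J, ‖z + w * k‖ ≤ C →
      ∃ p k', |k' + k| ≤ (D : ℤ) ∧ dist z (lam p + w * (k' : ℤ)) < ε := by
    intro J k hJ z hz hzk
    obtain ⟨y, hy, hzy⟩ := (hN₁ k Set.univ J (fun l => by simp)
      (fun l hl => ⟨fun _ => trivial, fun _ => hJ _ (by simpa using hl)⟩)).1 z hz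
      (hzk.trans (le_max_left _ _))
    rw [huniv] at hy
    obtain ⟨p, k', -, rfl⟩ := hy
    refine ⟨p, k', ?_, by linarith⟩
    have h1 : w * (k' + k : ℤ) = (lam p + w * k' - z) + (z + w * k) - lam p := by
      push_cast; ring
    have h2 := hnorm (k' + k)
    rw [h1] at h2
    have h3 := norm_sub_le ((lam p + w * k' - z) + (z + w * k)) (lam p)
    have h4 := norm_add_le (lam p + w * k' - z) (z + w * k)
    rw [dist_comm, dist_eq_norm] at hzy
    have h5 := hL p
    have h6 : ω * |((k' + k : ℤ) : ℝ)| ≤ ω * D := by linarith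
    have h7 := le_of_mul_le_mul_left h6 hω
    exact_mod_cast h7
  have low : ∀ (J : Set ℤ) (p : Fin n) (k : ℤ), (∀ l, |l + k| ≤ N₁ → l ∈ J) →
      ∃ y ∈ E J, dist (lam p + w * k) y < ε := by
    intro J p k hJ
    obtain ⟨y, hy, hzy⟩ := (hN₁ (-k) Set.univ J (fun l => by simp)
      (fun l hl => ⟨fun _ => trivial, fun _ => hJ _ (by simpa using hl)⟩)).2 (lam p + w * k)
      (by rw [huniv]; exact ⟨p, k, trivial, rfl⟩)
      (by push_cast
          rw [mul_neg, add_neg_cancel_right]; exact (hL p).trans (le_max_right _ _))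
    exact ⟨y, hy, by linarith⟩
  have approx : ∀ (I : Set ℤ) (p : Fin n) (k : ℤ), (∀ l, |l + k| ≤ N₂ → l ∈ I) →
      IsApproxEigenvalueByTrunc (harmonicMatrix T A) (harmonicIndex n I) ε (lam p + w * k) := by
    intro I p k hI
    refine hN₂ (Function.Embedding.refl _) (harmonicIndex n I) (-k) (lam p + w * k) ?_ ?_ ?_
    · have : lam p + w * k ∈ eigenvalueSet (harmonicMatrix T A) := by
        rw [heig]; exact ⟨p, k, trivial, rfl⟩
      exact this
    · push_cast
      rw [mul_neg, add_neg_cancel_right]; exact hL p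
    · intro q hq
      rw [range_harmonicIndex]
      exact hI _ (by simpa using hq)
  -- A fixed finite set, translated by `jωm`; the recursion in `m` is thus built in.
  set Λ₂ : ℕ → Set ℂ := fun m => (fun z => z + w * m) '' (E (Set.Ici 0) ∩ Metric.closedBall 0 R)
    with hΛ₂
  have hΛ : ∀ (m : ℕ) (y : ℂ), y ∈ Λ₂ m ↔ y ∈ E (Set.Ici (-(m : ℤ))) ∧ ‖y - w * m‖ ≤ R := by
    intro m y
    constructor
    · rintro ⟨z, ⟨hz, hzR⟩, rfl⟩
      have h1 := hshift (-m) (I := Set.Ici 0) (I' := Set.Ici (-(m : ℤ)))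
        (fun l => by simp) z hz
      refine ⟨?_, by simpa using hzR⟩
      convert! h1 using 1
      push_cast; ring
    · rintro ⟨hy, hyR⟩
      have h1 := hshift m (I := Set.Ici (-(m : ℤ))) (I' := Set.Ici 0)
        (fun l => by simp only [Set.mem_Ici]; omega) y hy
      exact ⟨y - w * m, ⟨by simpa using h1, by simpa using hyR⟩, by simp⟩
  have hedge : ∀ (m : ℕ) (k : ℤ) (z : ℂ), -(m : ℤ) ≤ k → k ≤ -m + G → ‖z + w * k‖ ≤ C →
      ‖z - w * m‖ ≤ C + ω * G := by
    intro m k z hk hk' hz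
    have h1 : z - w * m = (z + w * k) - w * (k + m : ℤ) := by push_cast; ring
    have h2 : |((k + m : ℤ) : ℝ)| ≤ G := by
      have : |k + m| ≤ (G : ℤ) := abs_le.2 ⟨by omega, by omega⟩
      exact_mod_cast this
    have h3 := norm_sub_le (z + w * k) (w * (k + m : ℤ))
    rw [hnorm, ← h1] at h3
    have h4 := mul_le_mul_of_nonneg_left h2 hω.le
    linarith
  -- For `m ≥ N₃ + N₄` the windows of half-widths `N₃` and `N₄` about one edge do not reach past the
  -- other.
  refine ⟨j₀, Λ₂, fun m => ⟨?_, hfin.image _, fun y hy => ((hΛ m y).1 hy).1, ?_, ?_, ?_⟩,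
    N₃ + N₄, fun m hm _ => ⟨?_, ?_, ?_, ?_, ?_⟩⟩
  · rintro _ ⟨p, k, hk, rfl⟩
    refine approx _ p k fun l hl => ?_
    have h1 := abs_le.1 hl
    have hk : k ≤ (m : ℤ) + 1 - j₀ := hk
    simp only [Set.mem_Ici]
    omega
  · simp only [hΛ₂, Set.image_image]
    refine Set.image_congr fun z _ => ?_
    push_cast; ring
  · intro z hz
    obtain ⟨k, hk, hzk⟩ := hC _ z hz
    have hk : -(m : ℤ) ≤ k := hk
    rw [Metric.mem_thickening_iff]
    by_cases hkG : k ≤ -m + G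
    · refine ⟨z, Or.inr ((hΛ m z).2 ⟨hz, ?_⟩), by simpa using hε⟩
      have := hedge m k z hk hkG hzk
      linarith
    · obtain ⟨p, k', hk', hdist⟩ := mid _ k (fun l hl => by
        have h1 := abs_le.1 hl
        simp only [Set.mem_Ici]
        omega) z hz hzk
      refine ⟨_, Or.inl ⟨p, k', ?_, rfl⟩, hdist⟩
      have h1 := abs_le.1 hk'
      show k' ≤ (m : ℤ) + 1 - j₀
      omega
  · rintro z (⟨p, k, hk, rfl⟩ | hz)
    · rw [Metric.mem_thickening_iff]
      refine low _ p k fun l hl => ?_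
      have h1 := abs_le.1 hl
      have hk : k ≤ (m : ℤ) + 1 - j₀ := hk
      simp only [Set.mem_Ici]
      omega
    · exact Metric.self_subset_thickening hε _ ((hΛ m z).1 hz).1
  · rintro _ ⟨p, k, hk, rfl⟩
    refine approx _ p k fun l hl => ?_
    have h1 := abs_le.1 hl
    have hk : |k| ≤ (m : ℤ) + 1 - j₀ := hk
    have h2 := abs_le.1 hk
    simp only [Set.mem_Icc]
    omega
  · intro z hz
    obtain ⟨hz1, hz2⟩ := (hΛ m z).1 hz
    refine hN₄ (harmonicIndex n (Set.Ici (-(m : ℤ)))) _ (-m) z hz1 ?_ fun p hp => ?_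
    · push_cast
      rwa [mul_neg, ← sub_eq_add_neg]
    · rw [range_harmonicInclusion]
      have h1 : |(p.2 : ℤ) - -m| ≤ N₄ := hp
      have h2 := abs_le.1 h1
      have h3 : -(m : ℤ) ≤ p.2 := p.2.2
      refine ⟨h3, ?_⟩
      omega
  · rintro _ ⟨z, hz, rfl⟩
    obtain ⟨hz1, hz2⟩ := (hΛ m z).1 hz
    have hz3 : star z ∈ E (Set.Iic (m : ℤ)) :=
      star_mem_truncEigenvalues (fun l => by simp only [Set.mem_Ici, Set.mem_Iic]; omega) hz1
    refine hN₄ (harmonicIndex n (Set.Iic (m : ℤ))) _ m (star z) hz3 ?_ fun p hp => ?_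
    · have h1 : star z + w * (m : ℤ) = star (z - w * m) := by
        rw [star_sub, star_mul', hwstar, star_natCast]; push_cast; ring
      rw [h1, norm_star]
      exact hz2
    · rw [range_harmonicInclusion]
      have h1 : |(p.2 : ℤ) - m| ≤ N₄ := hp
      have h2 := abs_le.1 h1
      have h3 : (p.2 : ℤ) ≤ m := p.2.2
      refine ⟨?_, h3⟩
      omega
  all_goals
    have hstarE : ∀ z ∈ E (Set.Icc (-(m : ℤ)) m), star z ∈ E (Set.Icc (-(m : ℤ)) m) := fun z hz =>
      star_mem_truncEigenvalues (fun l => by simp only [Set.mem_Icc]; omega) hz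
    -- Near `-m` the two-sided truncation is compared with the one-sided one.
    obtain ⟨happ₁, happ₂⟩ := hN₃ (-m) (Set.Ici (-(m : ℤ))) (Set.Icc (-(m : ℤ)) m)
      (fun l => by simp) (fun l hl => by
        have h1 := abs_le.1 hl
        simp only [Set.mem_Ici, Set.mem_Icc]
        omega)
    simp only [Int.cast_neg, Int.cast_natCast, mul_neg, ← sub_eq_add_neg] at happ₁ happ₂
  · have hleft : ∀ (k : ℤ) (z : ℂ), z ∈ E (Set.Icc (-(m : ℤ)) m) → -(m : ℤ) ≤ k → k ≤ -m + G →
        ‖z + w * k‖ ≤ C → ∃ y ∈ Λ₂ m, dist z y < ε := by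
      intro k z hz hk hk' hzk
      have h1 := hedge m k z hk hk' hzk
      obtain ⟨y, hy, hzy⟩ := happ₁ z hz (by linarith)
      refine ⟨y, (hΛ m y).2 ⟨hy, ?_⟩, by linarith⟩
      have h2 := norm_add_le (y - z) (z - w * m)
      rw [sub_add_sub_cancel, ← dist_eq_norm y z, dist_comm y z] at h2
      linarith
    intro z hz
    obtain ⟨k, hk, hzk⟩ := hC _ z hz
    have hk : -(m : ℤ) ≤ k ∧ k ≤ m := hk
    rw [Metric.mem_thickening_iff]
    by_cases h1 : k ≤ -m + G
    · obtain ⟨y, hy, hzy⟩ := hleft k z hz hk.1 h1 hzk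
      exact ⟨y, Or.inr hy, hzy⟩
    -- The zone near `m` is the mirror image of the one near `-m`: `star z` is an eigenvalue
    -- localised at `-k`.
    by_cases h2 : -k ≤ -m + G
    · have h3 : star z + w * (-k : ℤ) = star (z + w * k) := by
        rw [star_add, star_mul', hwstar, star_intCast]; push_cast; ring
      obtain ⟨y, hy, hzy⟩ := hleft (-k) (star z) (hstarE z hz) (by omega) h2 (by
        rw [h3, norm_star]; exact hzk)
      refine ⟨star y, Or.inl (Or.inr ⟨y, hy, rfl⟩), ?_⟩
      rwa [dist_eq_norm, ← norm_star, star_sub, star_star, ← dist_eq_norm]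
    · obtain ⟨p, k', hk', hdist⟩ := mid _ k (fun l hl => by
        have h1 := abs_le.1 hl
        simp only [Set.mem_Icc]
        omega) z hz hzk
      refine ⟨_, Or.inl (Or.inl ⟨p, k', ?_, rfl⟩), hdist⟩
      have h1 := abs_le.1 hk'
      show |k'| ≤ (m : ℤ) + 1 - j₀
      rw [abs_le]
      omega
  · have hright : ∀ z ∈ Λ₂ m, ∃ y ∈ E (Set.Icc (-(m : ℤ)) m), dist z y < ε := by
      intro z hz
      obtain ⟨hz1, hz2⟩ := (hΛ m z).1 hz
      obtain ⟨y, hy, hzy⟩ := happ₂ z hz1 hz2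
      exact ⟨y, hy, by linarith⟩
    rintro z ((⟨p, k, hk, rfl⟩ | ⟨z, hz, rfl⟩) | hz)
    · rw [Metric.mem_thickening_iff]
      refine low _ p k fun l hl => ?_
      have h1 := abs_le.1 hl
      have hk : |k| ≤ (m : ℤ) + 1 - j₀ := hk
      have h2 := abs_le.1 hk
      simp only [Set.mem_Icc]
      omega
    · obtain ⟨y, hy, hzy⟩ := hright z hz
      rw [Metric.mem_thickening_iff]
      refine ⟨star y, hstarE y hy, ?_⟩
      rwa [dist_eq_norm, ← star_sub, norm_star, ← dist_eq_norm]
    · exact Metric.mem_thickening_iff.2 (hright z hz)
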